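/- For $n\ge 0$ let $SG_4(n)$ be the four-dimensional Sierpinski gasket graph at stage $n$: $SG_4(0)$ is the complete graph on the five vertices of a 4-simplex, called its outmost vertices, and $SG_4(n+1)$ is obtained from five copies of $SG_4(n)$, placed in the five corners of a 4-simplex of twice the side length, by identifying, for each pair $i\ne j$, the $j$-th outmost vertex of the $i$-th copy with the $i$-th outmost vertex of the $j$-th copy; the $i$-th outmost vertex of $SG_4(n+1)$ is the $i$-th outmost vertex of the $i$-th copy. Let $v(G)$ denote the number of vertices of a finite graph $G$, and $N_{SF}(G)$ the number of its spanning forests, i.e. of its acyclic spanning subgraphs. Then the asymptotic growth constant $$z_{SG_4}=\lim_{n\to\infty}\frac{\ln N_{SF}(SG_4(n))}{v(SG_4(n))}$$ exists and $z_{SG_4}=1.98101707560\ldots$, that is, $1.98101707560\le z_{SG_4}<1.98101707561$. -/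

import Mathlib

/-- The number `N_SF(G)` of spanning forests of `G`: the number of acyclic spanning subgraphs,
that is, of acyclic graphs on the whole vertex set of `G` whose edges are all edges of `G`
(isolated vertices count as trees). -/
noncomputable def numSpanningForests {V : Type*} (G : SimpleGraph V) : ℕ :=
  Set.ncard {H : SimpleGraph V | H ≤ G ∧ H.IsAcyclic}

/-- The vertices of the `d`-dimensional Sierpinski gasket at stage `n`, drawn with edges of length
one in a `d`-simplex of side length `2 ^ n`, in barycentric coordinates: the `d + 1` outmost
vertices are the points `Pi.single i (2 ^ n)`. Stage `0` has the `d + 1` vertices of the unit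
simplex; stage `n + 1` consists of `d + 1` translates of stage `n`, one in each corner. -/
def sierpinskiVertices (d : ℕ) : ℕ → Finset (Fin (d + 1) → ℕ)
  | 0 => Finset.univ.image fun i => Pi.single i 1
  | n + 1 => Finset.univ.biUnion fun i : Fin (d + 1) =>
      (sierpinskiVertices d n).map (addRightEmbedding (Pi.single i (2 ^ n)))

/-- The edges of the `d`-dimensional Sierpinski gasket at stage `n`, as a graph on all lattice
points: stage `0` is the complete graph on the vertices of the unit simplex; stage `n + 1` is the
union of the `d + 1` translates of stage `n`. -/
def sierpinskiEdges (d : ℕ) : ℕ → SimpleGraph (Fin (d + 1) → ℕ)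
  | 0 => SimpleGraph.fromRel fun x y => x ∈ sierpinskiVertices d 0 ∧ y ∈ sierpinskiVertices d 0
  | n + 1 => ⨆ i : Fin (d + 1),
      (sierpinskiEdges d n).map (addRightEmbedding (Pi.single i (2 ^ n) : Fin (d + 1) → ℕ))

/-- The `d`-dimensional Sierpinski gasket `SG_d(n)` at stage `n`, a graph on its finite set of
vertices. -/
def sierpinskiGasket (d n : ℕ) : SimpleGraph (sierpinskiVertices d n) :=
  (sierpinskiEdges d n).comap Subtype.val

/-! Let F_n be the number of forests at stage n, and B_n the number of those that stay forests when
all five outmost vertices are identified. Stage n+1 consists of five copies of stage n that meet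
only in corners. Whatever is chosen in the other copies, a copy admits at most F_n choices and at
least B_n, the worst case being that all its corners are already connected. Hence F_{n+1} ≤ F_n^5
and B_n^5 ≤ B_{n+1}. As B_n ≤ F_n, the numbers ln F_n / 5^n decrease, the numbers ln B_n / 5^n
increase, and the latter stay below the former. Since there are 5(5^n+1)/2 vertices, the growth
constant is 2/5 of lim ln F_n / 5^n. The values F_6 and B_7 already give the stated digits.

These values come from an exact recursion. `ev X r` is the weighted sum over edge sets that are
independent modulo an identification `r` of vertices, computed by deletion and contraction. A piece
attached at five corners matters only through a function of partitions of the corners (`boundary`).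
Symmetry leaves seven types of partitions, and the linear relation `ev_four_point`, which holds for
every family of edges, leaves the five values on partitions with a single block
(`IsSymmetricFourPoint.eq_of_block`).

A star whose edges have weights 1-q (left out) and q (taken) satisfies the same relations, and its
block values are (1-q)^k (1+kq), 0 ≤ k ≤ 4. So a stage acts like a signed combination of stars with
q = 0, …, 5 and coefficients ω_q (`exists_represents`). It enters only through the moments m_t = ∑
ω_q q^t for t = 0, 2, 3, 4, 5. The block values have no linear term in q, so m_1 may be taken to be
0.

Replace all five copies in stage n+1 by stars. Every vertex other than a hub then meets at most two
edges and can be eliminated, which leaves a complete graph on five hubs with weights q_i q_j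
(`ev_stars_eq_ev_hubEdges`). Expanding into monomials gives homogeneous quintic polynomials in the
moments (`quintic`). To isolate m_t of the new stage, edges with weights (-1, 1) lead from one more
hub to t of the corners (`moment_eq`). The recursion `normalizedMoment_succ` starts from the
complete graph on five vertices and is run in integer arithmetic up to stage 7. -/

/-! ### Gluing the endpoints of edges -/

namespace Setoid

variable {V W : Type*}

/-- `r.Joins e` says that the endpoints of `e` are related by `r`. -/
def Joins (r : Setoid V) (e : Sym2 V) : Prop := ∃ u v, e = s(u, v) ∧ r u v

@[simp] theorem joins_mk {r : Setoid V} {u v : V} : r.Joins s(u, v) ↔ r u v := by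
  constructor
  · rintro ⟨a, b, h, hr⟩
    rcases Sym2.eq_iff.1 h with ⟨rfl, rfl⟩ | ⟨rfl, rfl⟩
    · exact hr
    · exact r.symm' hr
  · intro h
    exact ⟨u, v, rfl, h⟩

/-- The smallest equivalence relation above `r` that relates `u` and `v`. -/
def gluePair (r : Setoid V) (u v : V) : Setoid V where
  r x y := r x y ∨ (r x u ∧ r v y) ∨ (r x v ∧ r u y)
  iseqv :=
    { refl := fun x => Or.inl (r.refl' x)
      symm := by
        rintro x y (h | ⟨h, h'⟩ | ⟨h, h'⟩)
        · exact Or.inl (r.symm' h)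
        · exact Or.inr (Or.inr ⟨r.symm' h', r.symm' h⟩)
        · exact Or.inr (Or.inl ⟨r.symm' h', r.symm' h⟩)
      trans := by
        have t := @Setoid.trans' V r
        have s := @Setoid.symm' V r
        rintro x y z (h | ⟨h, h'⟩ | ⟨h, h'⟩) (k | ⟨k, k'⟩ | ⟨k, k'⟩)
        · exact Or.inl (t h k)
        · exact Or.inr (Or.inl ⟨t h k, k'⟩)
        · exact Or.inr (Or.inr ⟨t h k, k'⟩)
        · exact Or.inr (Or.inl ⟨h, t h' k⟩)
        · exact Or.inl (t (t h (s (t h' k))) k')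
        · exact Or.inl (t h k')
        · exact Or.inr (Or.inr ⟨h, t h' k⟩)
        · exact Or.inl (t h k')
        · exact Or.inl (t (t h (s (t h' k))) k') }

theorem gluePair_rel {r : Setoid V} {u v x y : V} :
    r.gluePair u v x y ↔ r x y ∨ (r x u ∧ r v y) ∨ (r x v ∧ r u y) := Iff.rfl

theorem gluePair_comm (r : Setoid V) (u v : V) : r.gluePair u v = r.gluePair v u := by
  ext x y
  simp only [gluePair_rel]
  tauto

/-- The smallest equivalence relation above `r` that relates the endpoints of `e`. -/
def glue (r : Setoid V) (e : Sym2 V) : Setoid V :=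
  Sym2.lift ⟨r.gluePair, r.gluePair_comm⟩ e

theorem glue_rel {r : Setoid V} {u v x y : V} :
    r.glue s(u, v) x y ↔ r x y ∨ (r x u ∧ r v y) ∨ (r x v ∧ r u y) := Iff.rfl

theorem glue_le_iff {r t : Setoid V} {u v : V} : r.glue s(u, v) ≤ t ↔ r ≤ t ∧ t u v := by
  constructor
  · intro h
    exact ⟨fun x y hxy => h (glue_rel.2 (Or.inl hxy)),
      h (glue_rel.2 (Or.inr (Or.inl ⟨r.refl' u, r.refl' v⟩)))⟩
  · rintro ⟨h, huv⟩ x y hxy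
    rcases glue_rel.1 hxy with h1 | ⟨h1, h2⟩ | ⟨h1, h2⟩
    · exact h h1
    · exact t.trans' (t.trans' (h h1) huv) (h h2)
    · exact t.trans' (t.trans' (h h1) (t.symm' huv)) (h h2)

theorem le_glue (r : Setoid V) (e : Sym2 V) : r ≤ r.glue e := by
  induction e with | _ u v => exact (glue_le_iff.1 le_rfl).1

theorem glue_mono {r t : Setoid V} (h : r ≤ t) (e : Sym2 V) : r.glue e ≤ t.glue e := by
  induction e with | _ u v =>
  exact glue_le_iff.2 ⟨h.trans (t.le_glue _), (glue_le_iff.1 le_rfl).2⟩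

theorem glue_comm (r : Setoid V) (e f : Sym2 V) : (r.glue e).glue f = (r.glue f).glue e := by
  induction e with | _ u v =>
  induction f with | _ x y =>
  refine eq_of_forall_ge_iff fun t => ?_
  simp only [glue_le_iff]
  tauto

/-- Both sides say that e and f together close no cycle modulo r, which does not depend on their
order. -/
theorem joins_glue_comm (r : Setoid V) (e f : Sym2 V) :
    (¬ r.Joins e ∧ ¬ (r.glue e).Joins f) ↔ (¬ r.Joins f ∧ ¬ (r.glue f).Joins e) := by
  induction e with | _ u v =>
  induction f with | _ x y =>
  simp only [joins_mk, glue_rel]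
  have h1 : r u x ↔ r x u := r.comm'
  have h2 : r u y ↔ r y u := r.comm'
  have h3 : r v x ↔ r x v := r.comm'
  have h4 : r v y ↔ r y v := r.comm'
  tauto

theorem comap_glue (ι : V → W) (r : Setoid W) (e : Sym2 V) :
    (r.glue (e.map ι)).comap ι = (r.comap ι).glue e := by
  induction e with | _ u v => rfl

theorem joins_map (ι : V → W) (r : Setoid W) (e : Sym2 V) :
    r.Joins (e.map ι) ↔ (r.comap ι).Joins e := by
  induction e with | _ u v =>
  rw [Sym2.map_mk, joins_mk, joins_mk]; rfl

/-- Relabelling after the classes of `u` and `v` are merged. -/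
def merge {L : Type*} [DecidableEq L] (f : V → L) (u v : V) (x : V) : L :=
  if f x = f v then f u else f x

theorem ker_glue {L : Type*} [DecidableEq L] (f : V → L) (u v : V) :
    (ker f).glue s(u, v) = ker (merge f u v) := by
  ext x y
  simp only [glue_rel, ker_def, merge]
  by_cases hx : f x = f v <;> by_cases hy : f y = f v <;> simp [hx, hy, eq_comm]
  · grind
  · grind

/-- `u` is alone in its class. -/
def Isolated (r : Setoid V) (u : V) : Prop := ∀ x, r u x → x = u

theorem isolated_bot (u : V) : (⊥ : Setoid V).Isolated u := fun _ h => Eq.symm h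

theorem Isolated.rel_iff {r : Setoid V} {u : V} (h : r.Isolated u) {x : V} : r u x ↔ u = x :=
  ⟨fun hx => (h x hx).symm, fun hx => hx ▸ r.refl' u⟩

theorem Isolated.rel_iff' {r : Setoid V} {u : V} (h : r.Isolated u) {x : V} : r x u ↔ x = u :=
  ⟨fun hx => h x (r.symm' hx), fun hx => hx ▸ r.refl' x⟩

theorem Isolated.glue {r : Setoid V} {u : V} (h : r.Isolated u) {e : Sym2 V} (he : u ∉ e) :
    (r.glue e).Isolated u := by
  induction e with | _ a b =>
  intro x hx
  rw [Sym2.mem_iff, not_or] at he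
  rcases glue_rel.1 hx with h1 | ⟨h1, _⟩ | ⟨h1, _⟩
  · exact h x h1
  · exact absurd (h _ h1).symm he.1
  · exact absurd (h _ h1).symm he.2

end Setoid

/-! ### Sums over the subsets of a family of edges that are independent modulo a relation -/

/-- A decision about an edge: leave it out with weight `skip`, or contract it with weight `take`. -/
structure EdgeOp (V R : Type*) where
  edge : Sym2 V
  skip : R
  take : R

namespace EdgeOp

variable {V W R : Type*}

/-- Relabelling of the vertices. -/
def map (ι : V → W) (o : EdgeOp V R) : EdgeOp W R := ⟨o.edge.map ι, o.skip, o.take⟩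

@[simp] theorem map_mk (ι : V → W) (e : Sym2 V) (a b : R) :
    EdgeOp.map ι ⟨e, a, b⟩ = ⟨e.map ι, a, b⟩ := rfl

variable [CommRing R]

open Classical in
/-- The effect of a decision on functions of the current identification of vertices: contracting
an edge is only allowed if its endpoints are not yet identified. -/
noncomputable def act (o : EdgeOp V R) (φ : Setoid V → R) (r : Setoid V) : R :=
  o.skip * φ r + if r.Joins o.edge then 0 else o.take * φ (r.glue o.edge)

/-- This makes the fold over a multiset in `ev` well defined and allows any edge to be treated
first. -/
theorem act_comm (o p : EdgeOp V R) (φ : Setoid V → R) : o.act (p.act φ) = p.act (o.act φ) := by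
  classical
  funext r
  have h := Setoid.joins_glue_comm r o.edge p.edge
  simp only [act, Setoid.glue_comm r o.edge p.edge]
  by_cases h1 : r.Joins o.edge <;> by_cases h2 : r.Joins p.edge <;>
    by_cases h3 : (r.glue o.edge).Joins p.edge <;> by_cases h4 : (r.glue p.edge).Joins o.edge <;>
    simp only [h1, h2, h3, h4, if_true, if_false] <;> first | (exfalso; tauto) | ring

instance : LeftCommutative (act : EdgeOp V R → (Setoid V → R) → Setoid V → R) := ⟨act_comm⟩

/-- The weighted sum over the subsets of the family `X` that are independent modulo `r`. -/
noncomputable def ev (X : Multiset (EdgeOp V R)) : Setoid V → R :=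
  X.foldr act fun _ => 1

@[simp] theorem ev_zero (r : Setoid V) : ev (0 : Multiset (EdgeOp V R)) r = 1 := rfl

theorem ev_cons (o : EdgeOp V R) (X : Multiset (EdgeOp V R)) : ev (o ::ₘ X) = o.act (ev X) :=
  Multiset.foldr_cons _ _ _ _

open Classical in
theorem ev_cons_apply (o : EdgeOp V R) (X : Multiset (EdgeOp V R)) (r : Setoid V) :
    ev (o ::ₘ X) r = o.skip * ev X r + if r.Joins o.edge then 0 else o.take * ev X (r.glue o.edge) :=
  congrFun (ev_cons o X) r

/-- The weights 0 and 1 force a contraction. In this way partitions of points are written as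
families of edges. -/
theorem ev_contract {X : Multiset (EdgeOp V R)} {r : Setoid V} {e : Sym2 V} (h : ¬ r.Joins e) :
    ev (⟨e, 0, 1⟩ ::ₘ X) r = ev X (r.glue e) := by
  simp [ev_cons_apply, h]

/-- Linear relations between the values of `ev` persist when further edges are added, as long as
they hold for all identifications that those edges may produce. -/
theorem ev_add_congr {κ : Type*} (s : Finset κ) (c : κ → R) (Y : κ → Multiset (EdgeOp V R))
    (Z : Multiset (EdgeOp V R)) (P : Setoid V → Prop)
    (hZ : ∀ r, P r → ev Z r = ∑ k ∈ s, c k * ev (Y k) r) (X : Multiset (EdgeOp V R))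
    (hX : ∀ o ∈ X, ∀ r, P r → P (r.glue o.edge)) (r : Setoid V) (hr : P r) :
    ev (X + Z) r = ∑ k ∈ s, c k * ev (X + Y k) r := by
  classical
  induction X using Multiset.induction_on generalizing r with
  | empty => simpa using hZ r hr
  | cons o X ih =>
    have ih' := ih fun p hp => hX p (Multiset.mem_cons_of_mem hp)
    simp only [Multiset.cons_add, ev_cons_apply]
    rw [ih' r hr, ih' _ (hX o (Multiset.mem_cons_self _ _) r hr)]
    by_cases h : r.Joins o.edge
    · simp only [h, if_true, add_zero, Finset.mul_sum]
      exact Finset.sum_congr rfl fun k _ => by ring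
    · simp only [h, if_false, Finset.mul_sum, ← Finset.sum_add_distrib]
      exact Finset.sum_congr rfl fun k _ => by ring

theorem ev_add_congr_one {Y Z : Multiset (EdgeOp V R)} (c : R) (P : Setoid V → Prop)
    (hZ : ∀ r, P r → ev Z r = c * ev Y r) (X : Multiset (EdgeOp V R))
    (hX : ∀ o ∈ X, ∀ r, P r → P (r.glue o.edge)) (r : Setoid V) (hr : P r) :
    ev (X + Z) r = c * ev (X + Y) r := by
  have := ev_add_congr (Finset.univ : Finset Unit) (fun _ => c) (fun _ => Y) Z P
    (by simpa using hZ) X hX r hr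
  simpa using this

theorem ev_map (ι : V → W) (X : Multiset (EdgeOp V R)) (r : Setoid W) :
    ev (X.map (EdgeOp.map ι)) r = ev X (r.comap ι) := by
  classical
  induction X using Multiset.induction_on generalizing r with
  | empty => rfl
  | cons o X ih =>
    rw [Multiset.map_cons, ev_cons_apply, ev_cons_apply, ih, ih]
    simp only [EdgeOp.map, Setoid.comap_glue, Setoid.joins_map]

/-- `ev X r` depends only on the identifications among the vertices that `X` touches. -/
theorem ev_congr (S : Set V) {X : Multiset (EdgeOp V R)} (hX : ∀ o ∈ X, ∀ x ∈ o.edge, x ∈ S)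
    {r t : Setoid V} (h : ∀ x ∈ S, ∀ y ∈ S, (r x y ↔ t x y)) : ev X r = ev X t := by
  classical
  induction X using Multiset.induction_on generalizing r t with
  | empty => rfl
  | cons o X ih =>
    have ih' := @ih fun p hp => hX p (Multiset.mem_cons_of_mem hp)
    have ho := hX o (Multiset.mem_cons_self _ _)
    obtain ⟨e, a, b⟩ := o
    induction e with | _ u v =>
    have hu : u ∈ S := ho u (Sym2.mem_mk_left u v)
    have hv : v ∈ S := ho v (Sym2.mem_mk_right u v)
    rw [ev_cons_apply, ev_cons_apply, ih' h]
    simp only [Setoid.joins_mk, h u hu v hv]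
    rw [@ih' (r.glue s(u, v)) (t.glue s(u, v))]
    intro x hx y hy
    simp only [Setoid.glue_rel, h x hx y hy, h x hx u hu, h v hv y hy, h x hx v hv, h u hu y hy]

/-- The four-point relation: the three pairings of four points together with the full block have
the same effect as the four blocks of three points. -/
theorem ev_four_point (X : Multiset (EdgeOp V R)) (r : Setoid V) (a b c d : V) :
    ev (⟨s(a, b), 0, 1⟩ ::ₘ ⟨s(c, d), 0, 1⟩ ::ₘ X) r +
      ev (⟨s(a, c), 0, 1⟩ ::ₘ ⟨s(b, d), 0, 1⟩ ::ₘ X) r +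
      ev (⟨s(a, d), 0, 1⟩ ::ₘ ⟨s(b, c), 0, 1⟩ ::ₘ X) r +
      ev (⟨s(a, b), 0, 1⟩ ::ₘ ⟨s(a, c), 0, 1⟩ ::ₘ ⟨s(a, d), 0, 1⟩ ::ₘ X) r =
    ev (⟨s(a, b), 0, 1⟩ ::ₘ ⟨s(a, c), 0, 1⟩ ::ₘ X) r +
      ev (⟨s(a, b), 0, 1⟩ ::ₘ ⟨s(a, d), 0, 1⟩ ::ₘ X) r +
      ev (⟨s(a, c), 0, 1⟩ ::ₘ ⟨s(a, d), 0, 1⟩ ::ₘ X) r +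
      ev (⟨s(b, c), 0, 1⟩ ::ₘ ⟨s(b, d), 0, 1⟩ ::ₘ X) r := by
  classical
  induction X using Multiset.induction_on generalizing r with
  | empty =>
    have s1 : ∀ x y, r x y ↔ r y x := fun x y => r.comm'
    have t := @Setoid.trans' V r
    simp only [ev_cons_apply, Setoid.joins_mk, Setoid.glue_rel, ev_zero, zero_mul, zero_add,
      one_mul]
    have e1 := s1 a b
    have e2 := s1 a c
    have e3 := s1 a d
    have e4 := s1 b c
    have e5 := s1 b d
    have e6 := s1 c d
    have t1 := @t a b c
    have t2 := @t a c b
    have t3 := @t b a c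
    have t4 := @t a b d
    have t5 := @t a d b
    have t6 := @t b a d
    have t7 := @t a c d
    have t8 := @t a d c
    have t9 := @t c a d
    have t10 := @t b c d
    have t11 := @t b d c
    have t12 := @t c b d
    simp only [← e1, ← e2, ← e3, ← e4, ← e5, ← e6] at *
    -- Without further edges each term is 1 or 0, according to the partition that r induces on the
    -- four points; transitivity excludes the patterns that are not partitions.
    by_cases hab : r a b <;> by_cases hac : r a c <;> by_cases had : r a d <;>
      by_cases hbc : r b c <;> by_cases hbd : r b d <;> by_cases hcd : r c d <;>
      simp only [hab, hac, had, hbc, hbd, hcd, true_imp_iff, false_imp_iff,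
        imp_false, not_true_eq_false, not_false_eq_true] at t1 t2 t3 t4 t5 t6 t7 t8 t9 t10 t11 t12 <;>
      simp [hab, hac, had, hbc, hbd, hcd]
  | cons o X ih =>
    -- The new edge is moved in front of the contractions, so the relation follows from those at r
    -- and at r with that edge glued.
    have k2 : ∀ p q : EdgeOp V R, ev (p ::ₘ q ::ₘ o ::ₘ X) r = o.skip * ev (p ::ₘ q ::ₘ X) r +
          if r.Joins o.edge then 0 else o.take * ev (p ::ₘ q ::ₘ X) (r.glue o.edge) := by
      intro p q
      rw [Multiset.cons_swap q o, Multiset.cons_swap p o, ev_cons_apply]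
    have k3 : ∀ p q w : EdgeOp V R, ev (p ::ₘ q ::ₘ w ::ₘ o ::ₘ X) r =
        o.skip * ev (p ::ₘ q ::ₘ w ::ₘ X) r +
          if r.Joins o.edge then 0 else o.take * ev (p ::ₘ q ::ₘ w ::ₘ X) (r.glue o.edge) := by
      intro p q w
      rw [Multiset.cons_swap w o, Multiset.cons_swap q o, Multiset.cons_swap p o, ev_cons_apply]
    simp only [k2, k3]
    by_cases h : r.Joins o.edge
    · simp only [h, if_true]
      linear_combination o.skip * ih r
    · simp only [h, if_false]
      linear_combination o.skip * ih r + o.take * ih (r.glue o.edge)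

end EdgeOp

/-! ### Spanning forests by deletion and contraction -/

namespace SimpleGraph

variable {V : Type*}

theorem reachableSetoid_le_of_adj {G : SimpleGraph V} {r : Setoid V}
    (h : ∀ x y, G.Adj x y → r x y) : G.reachableSetoid ≤ r := by
  rintro x y ⟨w⟩
  induction w with
  | nil => exact r.refl' _
  | cons h' _ ih => exact r.trans' (h _ _ h') ih

theorem reachableSetoid_sup_edge (G : SimpleGraph V) {u v : V} :
    (G ⊔ edge u v).reachableSetoid = G.reachableSetoid.glue s(u, v) := by
  apply le_antisymm
  · apply reachableSetoid_le_of_adj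
    intro x y hxy
    rcases (sup_adj _ _ _ _).1 hxy with h | h
    · exact Setoid.glue_rel.2 (Or.inl h.reachable)
    · rcases edge_adj .. |>.1 h with ⟨⟨rfl, rfl⟩ | ⟨rfl, rfl⟩, _⟩
      · exact Setoid.glue_rel.2 (Or.inr (Or.inl ⟨Reachable.refl _, Reachable.refl _⟩))
      · exact Setoid.glue_rel.2 (Or.inr (Or.inr ⟨Reachable.refl _, Reachable.refl _⟩))
  · rw [Setoid.glue_le_iff]
    refine ⟨fun x y h => Reachable.mono le_sup_left h, ?_⟩
    by_cases huv : u = v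
    · subst huv; exact Reachable.refl _
    · exact (Adj.reachable (by simp [edge_adj, huv]) : (G ⊔ edge u v).Reachable u v)

theorem reachableSetoid_bot : (⊥ : SimpleGraph V).reachableSetoid = ⊥ :=
  le_bot_iff.1 (reachableSetoid_le_of_adj fun _ _ h => absurd h (by simp))

end SimpleGraph

namespace EdgeOp

variable {V : Type*} {R : Type*} [CommRing R]

/-- The family of decisions whose weighted sum is the number of forests with edges in `E`. -/
def count (R : Type*) [CommRing R] (E : Multiset (Sym2 V)) : Multiset (EdgeOp V R) :=
  E.map fun e => ⟨e, 1, 1⟩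

@[simp] theorem count_zero : count R (0 : Multiset (Sym2 V)) = 0 := rfl

@[simp] theorem count_cons (e : Sym2 V) (E : Multiset (Sym2 V)) :
    count R (e ::ₘ E) = ⟨e, 1, 1⟩ ::ₘ count R E := Multiset.map_cons _ _ _

theorem count_map {W : Type*} (ι : V → W) (E : Multiset (Sym2 V)) :
    count R (E.map (Sym2.map ι)) = (count R E).map (EdgeOp.map ι) := by
  simp [count, Multiset.map_map, Function.comp_def]

theorem count_sum {κ : Type*} (s : Finset κ) (E : κ → Multiset (Sym2 V)) :
    count R (∑ k ∈ s, E k) = ∑ k ∈ s, count R (E k) :=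
  map_sum (Multiset.mapAddMonoidHom fun e : Sym2 V => (⟨e, 1, 1⟩ : EdgeOp V R)) E s

theorem mem_count {E : Multiset (Sym2 V)} {o : EdgeOp V R} (h : o ∈ count R E) : o.edge ∈ E := by
  obtain ⟨e, he, rfl⟩ := Multiset.mem_map.1 h
  exact he

-- Split according to whether H contains the next edge uv. If it does, H lies above F with uv added,
-- which is acyclic only when u and v are not connected in F; this is the test made by `act`.
open SimpleGraph in
theorem ncard_forests_between [Finite V] (E : Finset (Sym2 V)) (F : SimpleGraph V)
    (hF : F.IsAcyclic) (hE : ∀ e ∈ E, ¬ e.IsDiag ∧ e ∉ F.edgeSet) :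
    (Set.ncard {H : SimpleGraph V | F ≤ H ∧ H ≤ F ⊔ fromEdgeSet (E : Set (Sym2 V)) ∧
      H.IsAcyclic} : R) = ev (count R E.val) F.reachableSetoid := by
  classical
  induction E using Finset.induction_on generalizing F with
  | empty =>
    have : {H : SimpleGraph V | F ≤ H ∧ H ≤ F ⊔ fromEdgeSet ((∅ : Finset (Sym2 V)) : Set (Sym2 V)) ∧
      H.IsAcyclic} = {F} := by
      ext H
      simp only [Finset.coe_empty, fromEdgeSet_empty, sup_bot_eq, Set.mem_ofPred_eq,
        Set.mem_singleton_iff]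
      constructor
      · rintro ⟨h1, h2, _⟩; exact le_antisymm h2 h1
      · rintro rfl; exact ⟨le_rfl, le_rfl, hF⟩
    rw [this]
    simp
  | insert e E he ih =>
    obtain ⟨hd, heF⟩ := hE e (Finset.mem_insert_self _ _)
    have hE' := fun f hf => hE f (Finset.mem_insert_of_mem hf)
    rw [Finset.insert_val_of_notMem he, count_cons, ev_cons_apply, one_mul, one_mul, ← ih F hF hE']
    induction e with | _ u v =>
    have huv : u ≠ v := by simpa using hd
    have hFuv : ¬ F.Adj u v := heF
    have hsplit : {H : SimpleGraph V | F ≤ H ∧ H ≤ F ⊔ fromEdgeSet (↑(insert s(u, v) E)) ∧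
        H.IsAcyclic} = {H | F ≤ H ∧ H ≤ F ⊔ fromEdgeSet E ∧ H.IsAcyclic} ∪
          {H | F ⊔ SimpleGraph.edge u v ≤ H ∧ H ≤ (F ⊔ SimpleGraph.edge u v) ⊔ fromEdgeSet E ∧ H.IsAcyclic} := by
      have hins : fromEdgeSet (↑(insert s(u, v) E) : Set (Sym2 V)) =
          SimpleGraph.edge u v ⊔ fromEdgeSet E := by
        rw [Finset.coe_insert, Set.insert_eq, fromEdgeSet_union]; rfl
      ext H
      simp only [Set.mem_ofPred_eq, Set.mem_union, hins]
      rw [sup_assoc]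
      constructor
      · rintro ⟨h1, h2, h3⟩
        by_cases hH : H.Adj u v
        · exact Or.inr ⟨sup_le h1 (by rw [edge_le_iff]; exact Or.inr hH), h2, h3⟩
        · refine Or.inl ⟨h1, fun x y hxy => ?_, h3⟩
          rcases (sup_adj _ _ _ _).1 (h2 hxy) with h | h
          · exact Or.inl h
          · rcases (sup_adj _ _ _ _).1 h with h | h
            · rcases SimpleGraph.edge_adj .. |>.1 h with ⟨⟨rfl, rfl⟩ | ⟨rfl, rfl⟩, _⟩
              · exact absurd hxy hH
              · exact absurd hxy.symm hH
            · exact Or.inr h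
      · rintro (⟨h1, h2, h3⟩ | ⟨h1, h2, h3⟩)
        · exact ⟨h1, h2.trans (sup_le_sup_left le_sup_right _), h3⟩
        · exact ⟨le_sup_left.trans h1, h2, h3⟩
    have hdisj : Disjoint {H | F ≤ H ∧ H ≤ F ⊔ fromEdgeSet (E : Set (Sym2 V)) ∧ H.IsAcyclic}
          {H | F ⊔ SimpleGraph.edge u v ≤ H ∧ H ≤ (F ⊔ SimpleGraph.edge u v) ⊔ fromEdgeSet E ∧ H.IsAcyclic} := by
      rw [Set.disjoint_left]
      rintro H ⟨_, h2, _⟩ ⟨h1, _, _⟩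
      have hadj : H.Adj u v := h1 (by simp [edge_adj, huv])
      rcases (sup_adj _ _ _ _).1 (h2 hadj) with h | h
      · exact hFuv h
      · rw [fromEdgeSet_adj] at h
        exact he (by simpa using h.1)
    rw [hsplit, Set.ncard_union_eq hdisj (Set.toFinite _) (Set.toFinite _), Nat.cast_add]
    congr 1
    by_cases hr : F.reachableSetoid.Joins s(u, v)
    · rw [if_pos hr]
      have hr' : F.Reachable u v := Setoid.joins_mk.1 hr
      have : {H | F ⊔ SimpleGraph.edge u v ≤ H ∧ H ≤ (F ⊔ SimpleGraph.edge u v) ⊔ fromEdgeSet (E : Set (Sym2 V)) ∧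
          H.IsAcyclic} = ∅ := by
        rw [Set.eq_empty_iff_forall_notMem]
        rintro H ⟨h1, _, h3⟩
        rcases (isAcyclic_sup_fromEdgeSet_iff.1 (h3.anti h1)).2 hr' with h | h
        · exact huv h
        · exact hFuv h
      rw [this]; simp
    · rw [if_neg hr, ← reachableSetoid_sup_edge]
      have hr' : ¬ F.Reachable u v := fun h => hr (Setoid.joins_mk.2 h)
      refine ih _ (hF.sup_edge_of_not_reachable hr') fun f hf => ⟨(hE' f hf).1, fun hf' => ?_⟩
      rw [edgeSet_sup, Set.mem_union] at hf'
      rcases hf' with hf' | hf'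
      · exact (hE' f hf).2 hf'
      · rw [edgeSet_edge_of_ne huv, Set.mem_singleton_iff] at hf'
        exact he (hf' ▸ hf)

theorem numSpanningForests_eq [Finite V] (G : SimpleGraph V) (E : Finset (Sym2 V))
    (hE : (E : Set (Sym2 V)) = G.edgeSet) :
    (numSpanningForests G : R) = ev (count R E.val) ⊥ := by
  rw [← SimpleGraph.reachableSetoid_bot, ← ncard_forests_between E ⊥ SimpleGraph.isAcyclic_bot]
  · rw [hE]
    simp [numSpanningForests]
  · intro e he
    have : e ∈ G.edgeSet := hE ▸ he
    exact ⟨G.not_isDiag_of_mem_edgeSet this, by simp⟩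

/-! ### Monotonicity of the numbers of forests -/

section Order

variable [PartialOrder R] [IsOrderedRing R]

theorem ev_count_nonneg (E : Multiset (Sym2 V)) (r : Setoid V) : 0 ≤ ev (count R E) r := by
  classical
  induction E using Multiset.induction_on generalizing r with
  | empty => simp
  | cons e E ih =>
    rw [count_cons, ev_cons_apply, one_mul, one_mul]
    refine add_nonneg (ih _) ?_
    split_ifs
    · exact le_rfl
    · exact ih _

/-- An edge set that is independent modulo the coarser relation is also independent modulo the finer
one. -/
theorem ev_count_anti (E : Multiset (Sym2 V)) {r t : Setoid V} (h : r ≤ t) :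
    ev (count R E) t ≤ ev (count R E) r := by
  classical
  induction E using Multiset.induction_on generalizing r t with
  | empty => simp
  | cons e E ih =>
    rw [count_cons, ev_cons_apply, one_mul, one_mul, ev_cons_apply, one_mul, one_mul]
    refine add_le_add (ih h) ?_
    have hj : r.Joins e → t.Joins e := by
      rintro ⟨u, v, rfl, huv⟩
      exact Setoid.joins_mk.2 (h huv)
    by_cases ht : t.Joins e
    · rw [if_pos ht]
      split_ifs
      · exact le_rfl
      · exact ev_count_nonneg _ _
    · rw [if_neg ht, if_neg fun hr => ht (hj hr)]
      exact ih (Setoid.glue_mono h e)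

theorem one_le_ev_count (E : Multiset (Sym2 V)) (r : Setoid V) : 1 ≤ ev (count R E) r := by
  classical
  induction E using Multiset.induction_on generalizing r with
  | empty => simp
  | cons e E ih =>
    rw [count_cons, ev_cons_apply, one_mul, one_mul]
    refine le_add_of_le_of_nonneg (ih _) ?_
    split_ifs
    · exact le_rfl
    · exact ev_count_nonneg _ _

/-- Once the part of a forest in E is fixed, its part in F is independent modulo what has been glued
so far, so there are at most c choices. -/
theorem ev_count_add_le (E F : Multiset (Sym2 V)) (c : R) (hc : ∀ r, ev (count R F) r ≤ c)
    (r : Setoid V) : ev (count R (E + F)) r ≤ ev (count R E) r * c := by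
  classical
  induction E using Multiset.induction_on generalizing r with
  | empty => simpa using hc r
  | cons e E ih =>
    rw [Multiset.cons_add, count_cons, count_cons, ev_cons_apply, ev_cons_apply]
    simp only [one_mul, add_mul]
    refine add_le_add (ih r) ?_
    split_ifs
    · simp
    · exact ih _

/-- The lower bound for F need not hold for all relations, only for those reached by gluing edges of
E; P is an invariant that records this. -/
theorem le_ev_count_add (E F : Multiset (Sym2 V)) (c : R) (P : Setoid V → Prop)
    (hc : ∀ r, P r → c ≤ ev (count R F) r) (hE : ∀ e ∈ E, ∀ r, P r → P (r.glue e))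
    (r : Setoid V) (hr : P r) : ev (count R E) r * c ≤ ev (count R (E + F)) r := by
  classical
  induction E using Multiset.induction_on generalizing r with
  | empty => simpa using hc r hr
  | cons e E ih =>
    have ih' := ih fun f hf => hE f (Multiset.mem_cons_of_mem hf)
    rw [Multiset.cons_add, count_cons, count_cons, ev_cons_apply, ev_cons_apply]
    simp only [one_mul, add_mul]
    refine add_le_add (ih' r hr) ?_
    split_ifs
    · simp
    · exact ih' _ (hE e (Multiset.mem_cons_self _ _) r hr)

end Order

end EdgeOp

/-! ### Pieces attached to the rest of a graph at their corners -/

namespace Setoid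

variable {ι V W : Type*}

open Classical in
/-- The relation on `V` that identifies the points `c i` as prescribed by `s`. -/
noncomputable def extend (c : ι → V) (s : Setoid ι) : Setoid V :=
  ker fun x => if h : ∃ i, c i = x then Sum.inl (Quotient.mk s h.choose) else Sum.inr x

theorem extend_rel {c : ι → V} (hc : Function.Injective c) (s : Setoid ι) {i j : ι} :
    s.extend c (c i) (c j) ↔ s i j := by
  have hi : ∃ k, c k = c i := ⟨i, rfl⟩
  have hj : ∃ k, c k = c j := ⟨j, rfl⟩
  rw [extend, ker_def, dif_pos hi, dif_pos hj, hc hi.choose_spec, hc hj.choose_spec, Sum.inl.injEq,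
    Quotient.eq]

theorem extend_isolated {c : ι → V} (s : Setoid ι) {x : V} (hx : ∀ i, c i ≠ x) :
    (s.extend c).Isolated x := by
  have hx' : ¬ ∃ i, c i = x := fun ⟨i, hi⟩ => hx i hi
  intro y hy
  rw [extend, ker_def, dif_neg hx'] at hy
  split_ifs at hy
  exact (Sum.inr.inj hy).symm

theorem comap_extend {c : ι → V} (hc : Function.Injective c) (s : Setoid ι) :
    (s.extend c).comap c = s := by
  ext i j
  exact extend_rel hc s

theorem extend_glue {c : ι → V} (hc : Function.Injective c) (s : Setoid ι) (a b : ι) :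
    (s.glue s(a, b)).extend c = (s.extend c).glue s(c a, c b) := by
  ext x y
  by_cases hx : ∃ i, c i = x
  · obtain ⟨i, rfl⟩ := hx
    by_cases hy : ∃ j, c j = y
    · obtain ⟨j, rfl⟩ := hy
      simp only [extend_rel hc, glue_rel]
    · have hy' : ∀ j, c j ≠ y := fun j hj => hy ⟨j, hj⟩
      simp only [glue_rel, (extend_isolated _ hy').rel_iff', hy',
        and_false, or_self]
  · have hx' : ∀ i, c i ≠ x := fun i hi => hx ⟨i, hi⟩
    have hx'' : ∀ i, x ≠ c i := fun i => (hx' i).symm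
    simp only [glue_rel, (extend_isolated _ hx').rel_iff, hx'',
      false_and, or_false]

end Setoid

namespace EdgeOp

open Setoid

variable {ι V W R : Type*} [CommRing R]

/-- The weighted sum for a family with corners `c` as a function of the identification of the
corners. -/
noncomputable def boundary (X : Multiset (EdgeOp V R)) (c : ι → V) (s : Setoid ι) : R :=
  ev X (s.extend c)

/-- The hypothesis `hr` says that r identifies no interior vertex of the piece with another one, so
only the identifications among the corners count. -/
theorem ev_map_eq_boundary {X : Multiset (EdgeOp V R)} {c : ι → V} (hc : Function.Injective c)
    {S : Set V} (hX : ∀ o ∈ X, ∀ x ∈ o.edge, x ∈ S) (f : V → W) (r : Setoid W)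
    (hr : ∀ x ∈ S, (∀ i, c i ≠ x) → ∀ y, r (f x) (f y) → y = x) :
    ev (X.map (EdgeOp.map f)) r = boundary X c (r.comap (f ∘ c)) := by
  rw [ev_map, boundary]
  refine ev_congr S hX fun x hx y hy => ?_
  rw [comap_rel]
  by_cases hx' : ∃ i, c i = x
  · obtain ⟨i, rfl⟩ := hx'
    by_cases hy' : ∃ j, c j = y
    · obtain ⟨j, rfl⟩ := hy'
      rw [extend_rel hc]; rfl
    · have hy'' : ∀ j, c j ≠ y := fun j hj => hy' ⟨j, hj⟩
      rw [(extend_isolated _ hy'').rel_iff']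
      exact ⟨fun h => hr y hy hy'' _ (r.symm' h), fun h => h ▸ r.refl' _⟩
  · have hx'' : ∀ i, c i ≠ x := fun i hi => hx' ⟨i, hi⟩
    rw [(extend_isolated _ hx'').rel_iff]
    exact ⟨fun h => (hr x hx hx'' y h).symm, fun h => h ▸ r.refl' _⟩

theorem boundary_comap {X : Multiset (EdgeOp V R)} {c : ι → V} (hc : Function.Injective c)
    {f : V → V} (hf : Function.Injective f) {σ : ι → ι} (hσ : Function.Bijective σ)
    (hfc : ∀ i, f (c i) = c (σ i)) (hX : X.map (EdgeOp.map f) = X) (s : Setoid ι) :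
    boundary X c (s.comap σ) = boundary X c s := by
  have h := ev_map_eq_boundary (X := X) hc (S := Set.univ) (by simp) f (s.extend c) (by
    intro x _ hx y hy
    have hfx : ∀ i, c i ≠ f x := by
      intro i hi
      obtain ⟨j, rfl⟩ := hσ.2 i
      rw [← hfc] at hi
      exact hx j (hf hi)
    exact hf (extend_isolated s hfx _ hy))
  rw [hX] at h
  rw [boundary, boundary, h, boundary]
  congr 2
  ext i j
  simp only [comap_rel, Function.comp_apply, hfc, extend_rel hc]

/-- Functions of the identification of five corners that are symmetric and satisfy the four-point
relation. -/
structure IsSymmetricFourPoint (Z : Setoid (Fin 5) → R) : Prop where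
  symm : ∀ (σ : Equiv.Perm (Fin 5)) (s : Setoid (Fin 5)), Z (s.comap σ) = Z s
  four_point : ∀ (s : Setoid (Fin 5)) (a b c d : Fin 5), ¬ s a b → ¬ s a c → ¬ s a d → ¬ s b c →
    ¬ s b d → ¬ s c d →
    Z ((s.glue s(a, b)).glue s(c, d)) + Z ((s.glue s(a, c)).glue s(b, d)) +
      Z ((s.glue s(a, d)).glue s(b, c)) + Z (((s.glue s(a, b)).glue s(a, c)).glue s(a, d)) =
    Z ((s.glue s(a, b)).glue s(a, c)) + Z ((s.glue s(a, b)).glue s(a, d)) +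
      Z ((s.glue s(a, c)).glue s(a, d)) + Z ((s.glue s(b, c)).glue s(b, d))

theorem isSymmetricFourPoint_boundary {X : Multiset (EdgeOp V R)} {c : Fin 5 → V}
    (hc : Function.Injective c)
    (hX : ∀ σ : Equiv.Perm (Fin 5), ∃ f : V → V, Function.Injective f ∧ (∀ i, f (c i) = c (σ i)) ∧
      X.map (EdgeOp.map f) = X) :
    IsSymmetricFourPoint (boundary X c) where
  symm σ s := by
    obtain ⟨f, hf, hfc, hfX⟩ := hX σ
    exact boundary_comap hc hf σ.bijective hfc hfX s
  four_point s a b c' d hab hac had hbc hbd hcd := by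
    have key := ev_four_point X (s.extend c) (c a) (c b) (c c') (c d)
    have hba : ¬ s b a := fun h => hab (s.symm' h)
    have hca : ¬ s c' a := fun h => hac (s.symm' h)
    have hda : ¬ s d a := fun h => had (s.symm' h)
    have hcb : ¬ s c' b := fun h => hbc (s.symm' h)
    have hdb : ¬ s d b := fun h => hbd (s.symm' h)
    have hdc : ¬ s d c' := fun h => hcd (s.symm' h)
    simp only [boundary, extend_glue hc]
    have e : ∀ (r : Setoid V) (u v x y : V), ¬ r u v → ¬ (r.glue s(u, v)) x y →
        ev (⟨s(u, v), 0, 1⟩ ::ₘ ⟨s(x, y), 0, 1⟩ ::ₘ X) r =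
          ev X ((r.glue s(u, v)).glue s(x, y)) := by
      intro r u v x y h1 h2
      rw [ev_contract (by simpa using h1), ev_contract (by simpa using h2)]
    have e3 : ∀ (r : Setoid V) (u v x y z w : V), ¬ r u v → ¬ (r.glue s(u, v)) x y →
        ¬ ((r.glue s(u, v)).glue s(x, y)) z w →
        ev (⟨s(u, v), 0, 1⟩ ::ₘ ⟨s(x, y), 0, 1⟩ ::ₘ ⟨s(z, w), 0, 1⟩ ::ₘ X) r =
          ev X (((r.glue s(u, v)).glue s(x, y)).glue s(z, w)) := by
      intro r u v x y z w h1 h2 h3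
      rw [ev_contract (by simpa using h1), ev_contract (by simpa using h2),
        ev_contract (by simpa using h3)]
    rw [e, e, e, e, e, e, e, e3] at key
    · exact key
    all_goals simp only [glue_rel, extend_rel hc]
    all_goals simp [hab, hac, had, hbc, hbd, hcd, hba, hca, hcb, hdc]

end EdgeOp

/-! ### Equivalence relations on five points -/

namespace Setoid

/-- Label each point by the least element of its class. This leaves 2·3·4·5 label functions, few
enough for the exhaustive check in `exists_sortingPerm`. -/
theorem exists_eq_ker_le (s : Setoid (Fin 5)) : ∃ f : Fin 5 → Fin 5, (∀ i, f i ≤ i) ∧ s = ker f := by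
  classical
  have hne : ∀ i, (Finset.univ.filter fun j => s i j).Nonempty := fun i => ⟨i, by simp⟩
  refine ⟨fun i => (Finset.univ.filter fun j => s i j).min' (hne i), fun i => ?_, ?_⟩
  · exact Finset.min'_le _ _ (by simp)
  · ext i j
    rw [ker_def]
    constructor
    · intro h
      congr 1
      ext k
      simp only [Finset.mem_filter, Finset.mem_univ, true_and]
      exact ⟨fun hk => s.trans' (s.symm' h) hk, fun hk => s.trans' h hk⟩
    · intro h
      have hi := (Finset.mem_filter.1 (Finset.min'_mem _ (hne i))).2
      have hj := (Finset.mem_filter.1 (Finset.min'_mem _ (hne j))).2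
      rw [h] at hi
      exact s.trans' hi (s.symm' hj)

/-- Representatives of the types of partitions of five points. -/
def typeReps : List (Fin 5 → Fin 5) :=
  [![0, 1, 2, 3, 4], ![0, 0, 2, 3, 4], ![0, 0, 0, 3, 4], ![0, 0, 0, 0, 4], ![0, 0, 0, 0, 0],
    ![0, 0, 2, 2, 4], ![0, 0, 2, 2, 2]]

/-- Permutations that suffice to bring every partition of five points to a standard form. -/
def sortingPerms : List (Fin 5 → Fin 5) :=
  [![0, 1, 2, 3, 4], ![0, 1, 3, 4, 2], ![0, 2, 4, 1, 3], ![1, 2, 3, 0, 4], ![2, 3, 0, 4, 1],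
    ![2, 4, 1, 0, 3], ![0, 4, 1, 2, 3], ![3, 4, 1, 2, 0], ![1, 3, 0, 2, 4], ![0, 3, 4, 1, 2],
    ![1, 4, 2, 3, 0], ![3, 4, 2, 0, 1], ![0, 3, 2, 4, 1], ![0, 4, 1, 3, 2], ![1, 3, 2, 4, 0]]

theorem exists_sortingPerm : ∀ (b : Fin 2) (c : Fin 3) (d : Fin 4) (e : Fin 5),
    ∃ σ ∈ sortingPerms, ∃ g ∈ typeReps, ∀ i j : Fin 5,
      (![0, b.castLE (by decide), c.castLE (by decide), d.castLE (by decide), e] (σ i) =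
        ![0, b.castLE (by decide), c.castLE (by decide), d.castLE (by decide), e] (σ j)) ↔
      g i = g j := by
  decide +kernel

theorem injective_of_mem_sortingPerms : ∀ σ ∈ sortingPerms, Function.Injective σ := by
  decide +kernel

theorem exists_comap_eq_ker (s : Setoid (Fin 5)) :
    ∃ σ : Equiv.Perm (Fin 5), ∃ g ∈ typeReps, s.comap σ = ker g := by
  obtain ⟨f, hf, rfl⟩ := s.exists_eq_ker_le
  obtain ⟨σ, hσ, g, hg, h⟩ := exists_sortingPerm ⟨f 1, Nat.lt_succ_of_le (hf 1)⟩
    ⟨f 2, Nat.lt_succ_of_le (hf 2)⟩ ⟨f 3, Nat.lt_succ_of_le (hf 3)⟩ (f 4)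
  have hv : (![0, f 1, f 2, f 3, f 4] : Fin 5 → Fin 5) = f := by
    funext i
    fin_cases i
    · exact (Fin.le_zero_iff.1 (hf 0)).symm
    all_goals rfl
  have h' : ∀ i j, ((![0, f 1, f 2, f 3, f 4] : Fin 5 → Fin 5) (σ i) =
      (![0, f 1, f 2, f 3, f 4] : Fin 5 → Fin 5) (σ j)) ↔ g i = g j := h
  rw [hv] at h'
  refine ⟨Equiv.ofBijective σ ((injective_of_mem_sortingPerms σ hσ).bijective_of_finite), g, hg, ?_⟩
  ext i j
  rw [comap_rel, ker_def, ker_def, ← h' i j]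
  rfl

end Setoid

namespace EdgeOp

open Setoid

/-- The relation on five points that identifies the first `k` of them. -/
def block (k : ℕ) : Setoid (Fin 5) := ker fun i => if (i : ℕ) < k then 0 else (i : ℕ)

variable {K : Type*} [Field K]

theorem IsSymmetricFourPoint.apply_ker_eq {Z : Setoid (Fin 5) → K} (hZ : IsSymmetricFourPoint Z)
    {L L' : Type*} {f : Fin 5 → L} {g : Fin 5 → L'} (σ : Equiv.Perm (Fin 5))
    (h : ∀ i j, f (σ i) = f (σ j) ↔ g i = g j) : Z (ker f) = Z (ker g) := by
  rw [← hZ.symm σ]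
  congr 1
  ext i j
  exact h i j

theorem IsSymmetricFourPoint.apply_glue_glue {Z : Setoid (Fin 5) → K}
    (hZ : IsSymmetricFourPoint Z) {L L' : Type*} [DecidableEq L] {f : Fin 5 → L} {g : Fin 5 → L'}
    {u v x y : Fin 5} (σ : Equiv.Perm (Fin 5))
    (h : ∀ i j, merge (merge f u v) x y (σ i) = merge (merge f u v) x y (σ j) ↔ g i = g j) :
    Z (((ker f).glue s(u, v)).glue s(x, y)) = Z (ker g) := by
  rw [ker_glue, ker_glue]
  exact hZ.apply_ker_eq σ h

/-- Apply the four-point relation to the points 0, 1, 2, 3: by symmetry the three pairings have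
equal values, and so do the four triples. -/
theorem IsSymmetricFourPoint.ker_two_two {Z : Setoid (Fin 5) → K} (hZ : IsSymmetricFourPoint Z) :
    3 * Z (ker ![(0 : Fin 5), 0, 2, 2, 4]) + Z (block 4) = 4 * Z (block 3) := by
  have h := hZ.four_point (ker (id : Fin 5 → Fin 5)) 0 1 2 3 (by simp [ker_def])
    (by simp [ker_def]) (by simp [ker_def]) (by simp [ker_def]) (by simp [ker_def])
    (by simp [ker_def])
  rw [hZ.apply_glue_glue (g := ![(0 : Fin 5), 0, 2, 2, 4]) 1 (by decide),
    hZ.apply_glue_glue (g := ![(0 : Fin 5), 0, 2, 2, 4]) (Equiv.swap 1 2) (by decide),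
    hZ.apply_glue_glue (g := ![(0 : Fin 5), 0, 2, 2, 4]) (Equiv.swap 1 3) (by decide),
    ker_glue id 0 1,
    hZ.apply_glue_glue (g := fun i : Fin 5 => if (i : ℕ) < 4 then 0 else (i : ℕ)) 1 (by decide),
    ← ker_glue id 0 1,
    hZ.apply_glue_glue (g := fun i : Fin 5 => if (i : ℕ) < 3 then 0 else (i : ℕ)) 1 (by decide),
    hZ.apply_glue_glue (g := fun i : Fin 5 => if (i : ℕ) < 3 then 0 else (i : ℕ))
      (Equiv.swap 2 3) (by decide),
    hZ.apply_glue_glue (g := fun i : Fin 5 => if (i : ℕ) < 3 then 0 else (i : ℕ))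
      (Equiv.swap 1 3) (by decide),
    hZ.apply_glue_glue (g := fun i : Fin 5 => if (i : ℕ) < 3 then 0 else (i : ℕ))
      (Equiv.swap 0 3) (by decide)] at h
  simp only [block]
  linear_combination h

/-- Apply the four-point relation with 3 and 4 identified beforehand. The pairings and the triple 0,
1, 2 are then of type 3+2, and the other three triples become blocks of four, so one of the three
pairings cancels. -/
theorem IsSymmetricFourPoint.ker_three_two {Z : Setoid (Fin 5) → K}
    (hZ : IsSymmetricFourPoint Z) :
    2 * Z (ker ![(0 : Fin 5), 0, 2, 2, 2]) + Z (block 5) = 3 * Z (block 4) := by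
  have h := hZ.four_point (ker ![(0 : Fin 5), 1, 2, 3, 3]) 0 1 2 3 (by simp [ker_def])
    (by simp [ker_def]) (by simp [ker_def]) (by simp [ker_def]) (by simp [ker_def])
    (by simp [ker_def])
  rw [hZ.apply_glue_glue (g := ![(0 : Fin 5), 0, 2, 2, 2]) 1 (by decide),
    hZ.apply_glue_glue (g := ![(0 : Fin 5), 0, 2, 2, 2]) (Equiv.swap 1 2) (by decide),
    hZ.apply_glue_glue (g := ![(0 : Fin 5), 0, 2, 2, 2]) (Equiv.swap 0 2) (by decide),
    ker_glue _ 0 1,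
    hZ.apply_glue_glue (g := fun i : Fin 5 => if (i : ℕ) < 5 then 0 else (i : ℕ)) 1 (by decide),
    ← ker_glue _ 0 1,
    hZ.apply_glue_glue (g := ![(0 : Fin 5), 0, 2, 2, 2])
      (Equiv.swap 0 3 * Equiv.swap 1 4) (by decide),
    hZ.apply_glue_glue (g := fun i : Fin 5 => if (i : ℕ) < 4 then 0 else (i : ℕ))
      (Equiv.swap 2 4) (by decide),
    hZ.apply_glue_glue (g := fun i : Fin 5 => if (i : ℕ) < 4 then 0 else (i : ℕ))
      (Equiv.swap 1 4) (by decide),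
    hZ.apply_glue_glue (g := fun i : Fin 5 => if (i : ℕ) < 4 then 0 else (i : ℕ))
      (Equiv.swap 0 4) (by decide)] at h
  simp only [block]
  linear_combination h

/-- Functions as in `IsSymmetricFourPoint` are determined by their values on single blocks. -/
theorem IsSymmetricFourPoint.eq_of_block [CharZero K] {Z Z' : Setoid (Fin 5) → K}
    (hZ : IsSymmetricFourPoint Z) (hZ' : IsSymmetricFourPoint Z')
    (h : ∀ k ∈ Finset.Icc 1 5, Z (block k) = Z' (block k)) : Z = Z' := by
  have h3 := h 3 (by decide)
  have h4 := h 4 (by decide)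
  have h5 := h 5 (by decide)
  have b : ∀ k ∈ Finset.Icc 1 5, ∀ g : Fin 5 → Fin 5,
      (∀ i j : Fin 5, g i = g j ↔ (if (i : ℕ) < k then 0 else (i : ℕ)) =
        (if (j : ℕ) < k then 0 else (j : ℕ))) → Z (ker g) = Z' (ker g) := by
    intro k hk g hg
    have : ker g = block k := by
      ext i j
      exact hg i j
    rw [this]
    exact h k hk
  funext s
  obtain ⟨σ, g, hg, hs⟩ := s.exists_comap_eq_ker
  rw [← hZ.symm σ, ← hZ'.symm σ, hs]
  simp only [typeReps, List.mem_cons, List.not_mem_nil, or_false] at hg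
  rcases hg with rfl | rfl | rfl | rfl | rfl | rfl | rfl
  · exact b 1 (by decide) _ (by decide)
  · exact b 2 (by decide) _ (by decide)
  · exact b 3 (by decide) _ (by decide)
  · exact b 4 (by decide) _ (by decide)
  · exact b 5 (by decide) _ (by decide)
  · have e := hZ.ker_two_two
    have e' := hZ'.ker_two_two
    have : (3 : K) * Z (ker ![(0 : Fin 5), 0, 2, 2, 4]) = 3 * Z' (ker ![(0 : Fin 5), 0, 2, 2, 4]) := by
      linear_combination e - e' + 4 * h3 - h4
    exact mul_left_cancel₀ (by norm_num) this
  · have e := hZ.ker_three_two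
    have e' := hZ'.ker_three_two
    have : (2 : K) * Z (ker ![(0 : Fin 5), 0, 2, 2, 2]) = 2 * Z' (ker ![(0 : Fin 5), 0, 2, 2, 2]) := by
      linear_combination e - e' + 3 * h4 - h5
    exact mul_left_cancel₀ (by norm_num) this

theorem isSymmetricFourPoint_sum {κ : Type*} (t : Finset κ) (w : κ → K)
    (Z : κ → Setoid (Fin 5) → K) (hZ : ∀ k, IsSymmetricFourPoint (Z k)) :
    IsSymmetricFourPoint fun s => ∑ k ∈ t, w k * Z k s where
  symm σ s := Finset.sum_congr rfl fun k _ => by rw [(hZ k).symm]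
  four_point s a b c d h1 h2 h3 h4 h5 h6 := by
    simp only [← Finset.sum_add_distrib]
    exact Finset.sum_congr rfl fun k _ => by
      linear_combination w k * (hZ k).four_point s a b c d h1 h2 h3 h4 h5 h6

end EdgeOp

/-! ### The edges of the Sierpinski gasket -/

namespace SierpinskiGasket

open EdgeOp

variable {d : ℕ}

/-- The translation that moves stage `n` into the corner `i` of stage `n + 1`. -/
def shift (n : ℕ) (i : Fin (d + 1)) (x : Fin (d + 1) → ℕ) : Fin (d + 1) → ℕ :=
  x + Pi.single i (2 ^ n)

/-- The outmost vertices at stage `n`. -/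
def corner (n : ℕ) (i : Fin (d + 1)) : Fin (d + 1) → ℕ := Pi.single i (2 ^ n)

theorem shift_injective (n : ℕ) (i : Fin (d + 1)) : Function.Injective (shift n i) :=
  fun _ _ h => add_right_cancel h

theorem corner_injective (n : ℕ) : Function.Injective (corner (d := d) n) := by
  intro i j h
  by_contra hij
  have := congrFun h i
  simp [corner, Pi.single_eq_of_ne hij] at this

theorem shift_corner_comm (n : ℕ) (i j : Fin (d + 1)) :
    shift n i (corner n j) = shift n j (corner n i) := add_comm _ _

theorem shift_corner_self (n : ℕ) (i : Fin (d + 1)) : shift n i (corner n i) = corner (n + 1) i := by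
  simp only [shift, corner, ← Pi.single_add, pow_succ, mul_two]

/-- A sum of two unit vectors determines the unordered pair of indices. Diagonal pairs give the
outmost vertices of stage n+1, the others the points shared by two copies. -/
theorem shift_corner_eq_iff {n : ℕ} {i j k l : Fin (d + 1)} :
    shift n i (corner n j) = shift n k (corner n l) ↔ s(i, j) = s(k, l) := by
  constructor
  · intro h
    have hp : (0 : ℕ) < 2 ^ n := by positivity
    have key : ∀ a : Fin (d + 1), ((if a = j then 2 ^ n else 0) + if a = i then 2 ^ n else 0 : ℕ) =
        (if a = l then 2 ^ n else 0) + if a = k then 2 ^ n else 0 := by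
      intro a
      simpa [shift, corner, Pi.single_apply] using congrFun h a
    have hi := key i
    have hj := key j
    rw [Sym2.eq_iff]
    have hk := key k
    have hl := key l
    by_cases h1 : i = k <;> by_cases h2 : i = l <;> by_cases h3 : j = k <;> by_cases h4 : j = l <;>
      by_cases h5 : i = j <;> by_cases h6 : k = l <;> simp_all
  · intro h
    rcases Sym2.eq_iff.1 h with ⟨rfl, rfl⟩ | ⟨rfl, rfl⟩
    · rfl
    · exact shift_corner_comm _ _ _

theorem mem_vertices_succ {n : ℕ} {x : Fin (d + 1) → ℕ} :
    x ∈ sierpinskiVertices d (n + 1) ↔ ∃ i, ∃ y ∈ sierpinskiVertices d n, shift n i y = x := by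
  simp [sierpinskiVertices, shift]

theorem corner_mem (n : ℕ) (i : Fin (d + 1)) : corner n i ∈ sierpinskiVertices d n := by
  induction n with
  | zero => simp [sierpinskiVertices, corner]
  | succ n ih => exact mem_vertices_succ.2 ⟨i, _, ih, shift_corner_self n i⟩

theorem sum_eq_of_mem {n : ℕ} {x : Fin (d + 1) → ℕ} (hx : x ∈ sierpinskiVertices d n) :
    ∑ i, x i = 2 ^ n := by
  induction n generalizing x with
  | zero =>
    obtain ⟨i, -, rfl⟩ := Finset.mem_image.1 hx
    simp
  | succ n ih =>
    obtain ⟨i, y, hy, rfl⟩ := mem_vertices_succ.1 hx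
    simp [shift, Finset.sum_add_distrib, ih hy, pow_succ, mul_two]

/-- Copies meet only in their corners. -/
theorem eq_corner_of_shift_eq {n : ℕ} {i j : Fin (d + 1)} (hij : i ≠ j) {x y : Fin (d + 1) → ℕ}
    (hx : x ∈ sierpinskiVertices d n) (h : shift n i x = shift n j y) : x = corner n j := by
  have hj := congrFun h j
  simp only [shift, Pi.add_apply, Pi.single_eq_same, Pi.single_eq_of_ne hij.symm, add_zero] at hj
  have hsum := sum_eq_of_mem hx
  rw [← Finset.add_sum_erase _ _ (Finset.mem_univ j)] at hsum
  have h0 : ∑ k ∈ Finset.univ.erase j, x k = 0 := by omega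
  funext k
  by_cases hk : k = j
  · subst hk
    rw [corner, Pi.single_eq_same]
    omega
  · rw [corner, Pi.single_eq_of_ne hk]
    exact Finset.sum_eq_zero_iff.1 h0 k (by simp [hk])

/-- The edges at stage `n`. -/
def edges (d : ℕ) : ℕ → Multiset (Sym2 (Fin (d + 1) → ℕ))
  | 0 => (Finset.univ.filter fun e : Sym2 (Fin (d + 1)) => ¬ e.IsDiag).val.map
      (Sym2.map (corner 0))
  | n + 1 => ∑ i, (edges d n).map (Sym2.map (shift n i))

theorem mem_edges_succ {n : ℕ} {e : Sym2 (Fin (d + 1) → ℕ)} :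
    e ∈ edges d (n + 1) ↔ ∃ i, ∃ f ∈ edges d n, f.map (shift n i) = e := by
  simp [edges, Multiset.mem_sum]

theorem mem_vertices_of_mem_edges {n : ℕ} {e : Sym2 (Fin (d + 1) → ℕ)} (he : e ∈ edges d n)
    {x : Fin (d + 1) → ℕ} (hx : x ∈ e) : x ∈ sierpinskiVertices d n := by
  induction n generalizing e x with
  | zero =>
    obtain ⟨f, -, rfl⟩ := Multiset.mem_map.1 he
    obtain ⟨i, -, rfl⟩ := Sym2.mem_map.1 hx
    exact corner_mem 0 i
  | succ n ih =>
    obtain ⟨i, f, hf, rfl⟩ := mem_edges_succ.1 he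
    obtain ⟨y, hy, rfl⟩ := Sym2.mem_map.1 hx
    exact mem_vertices_succ.2 ⟨i, y, ih hf hy, rfl⟩

theorem not_isDiag_of_mem_edges {n : ℕ} {e : Sym2 (Fin (d + 1) → ℕ)} (he : e ∈ edges d n) :
    ¬ e.IsDiag := by
  induction n generalizing e with
  | zero =>
    obtain ⟨f, hf, rfl⟩ := Multiset.mem_map.1 he
    rw [Sym2.isDiag_map (corner_injective 0)]
    simpa using hf
  | succ n ih =>
    obtain ⟨i, f, hf, rfl⟩ := mem_edges_succ.1 he
    rw [Sym2.isDiag_map (shift_injective n i)]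
    exact ih hf

/-- Two copies share only one vertex, so a common edge would be a loop. -/
theorem nodup_edges (n : ℕ) : (edges d n).Nodup := by
  induction n with
  | zero => exact (Finset.nodup _).map (Sym2.map.injective (corner_injective 0))
  | succ n ih =>
    rw [edges, Finset.sum_eq_multiset_sum]
    have : (Multiset.map (fun i => (edges d n).map (Sym2.map (shift n i)))
        (Finset.univ : Finset (Fin (d + 1))).val).sum =
        (Finset.univ : Finset (Fin (d + 1))).val.bind
          fun i => (edges d n).map (Sym2.map (shift n i)) := rfl
    rw [this, Multiset.nodup_bind]
    refine ⟨fun i _ => ih.map (Sym2.map.injective (shift_injective n i)), ?_⟩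
    refine Multiset.Nodup.pairwise (fun i _ j _ hij => ?_) (Finset.nodup _)
    rw [Function.onFun, Multiset.disjoint_left]
    intro e he he'
    obtain ⟨f, hf, rfl⟩ := Multiset.mem_map.1 he
    obtain ⟨g, hg, hgf⟩ := Multiset.mem_map.1 he'
    have hc : ∀ x ∈ f, x = corner n j := by
      intro x hx
      have : shift n i x ∈ g.map (shift n j) := hgf ▸ Sym2.mem_map.2 ⟨x, hx, rfl⟩
      obtain ⟨y, -, hy⟩ := Sym2.mem_map.1 this
      exact eq_corner_of_shift_eq hij (mem_vertices_of_mem_edges hf hx) hy.symm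
    apply not_isDiag_of_mem_edges hf
    induction f with | _ u v =>
    rw [Sym2.mk_isDiag_iff, hc u (Sym2.mem_mk_left u v), hc v (Sym2.mem_mk_right u v)]

theorem mem_edges_iff {n : ℕ} {e : Sym2 (Fin (d + 1) → ℕ)} :
    e ∈ edges d n ↔ e ∈ (sierpinskiEdges d n).edgeSet := by
  induction n generalizing e with
  | zero =>
    induction e with | _ u v =>
    rw [SimpleGraph.mem_edgeSet, sierpinskiEdges, SimpleGraph.fromRel_adj]
    constructor
    · intro h
      exact ⟨by simpa using not_isDiag_of_mem_edges h,
        Or.inl ⟨mem_vertices_of_mem_edges h (Sym2.mem_mk_left u v),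
          mem_vertices_of_mem_edges h (Sym2.mem_mk_right u v)⟩⟩
    · rintro ⟨huv, h⟩
      have h' : u ∈ sierpinskiVertices d 0 ∧ v ∈ sierpinskiVertices d 0 := h.elim id And.symm
      obtain ⟨i, -, rfl⟩ := Finset.mem_image.1 h'.1
      obtain ⟨j, -, rfl⟩ := Finset.mem_image.1 h'.2
      refine Multiset.mem_map.2 ⟨s(i, j), ?_, by simp [corner]⟩
      have : i ≠ j := fun hij => huv (by rw [hij])
      simpa using this
  | succ n ih =>
    rw [mem_edges_succ]
    induction e with | _ u v =>
    rw [SimpleGraph.mem_edgeSet, sierpinskiEdges, SimpleGraph.iSup_adj]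
    constructor
    · rintro ⟨i, f, hf, h⟩
      refine ⟨i, ?_⟩
      induction f with | _ a b =>
      have hab := ih.1 hf
      rw [SimpleGraph.mem_edgeSet] at hab
      rw [SimpleGraph.map_adj]
      rcases Sym2.eq_iff.1 h with ⟨rfl, rfl⟩ | ⟨rfl, rfl⟩
      · exact ⟨a, b, hab, rfl, rfl⟩
      · exact ⟨b, a, hab.symm, rfl, rfl⟩
    · rintro ⟨i, h⟩
      rw [SimpleGraph.map_adj] at h
      obtain ⟨a, b, hab, rfl, rfl⟩ := h
      exact ⟨i, s(a, b), ih.2 hab, rfl⟩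

theorem numSpanningForests_eq_ev {R : Type*} [CommRing R] (d n : ℕ) :
    (numSpanningForests (sierpinskiGasket d n) : R) = ev (count R (edges d n)) ⊥ := by
  classical
  set G := sierpinskiGasket d n with hG
  rw [numSpanningForests_eq G G.edgeFinset (by simp)]
  have hmap : G.edgeFinset.val.map (Sym2.map Subtype.val) = edges d n := by
    refine (Multiset.Nodup.ext ((Finset.nodup _).map
      (Sym2.map.injective Subtype.val_injective)) (nodup_edges n)).2 fun e => ?_
    rw [mem_edges_iff, Multiset.mem_map]
    constructor
    · rintro ⟨f, hf, rfl⟩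
      induction f with | _ u v =>
      have : G.Adj u v := by simpa using hf
      exact this
    · intro he
      have hv := fun x (hx : x ∈ e) => mem_vertices_of_mem_edges (mem_edges_iff.2 he) hx
      induction e with | _ u v =>
      refine ⟨s(⟨u, hv u (Sym2.mem_mk_left u v)⟩, ⟨v, hv v (Sym2.mem_mk_right u v)⟩), ?_, rfl⟩
      rw [Finset.mem_val, SimpleGraph.mem_edgeFinset, SimpleGraph.mem_edgeSet]
      exact he
  rw [← hmap, count_map, ev_map]
  congr 1
  ext x y
  exact (Subtype.val_injective.eq_iff (a := x) (b := y)).symm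

/-- Permutation of the coordinates. -/
def permute (σ : Equiv.Perm (Fin (d + 1))) (x : Fin (d + 1) → ℕ) : Fin (d + 1) → ℕ := x ∘ σ.symm

theorem permute_injective (σ : Equiv.Perm (Fin (d + 1))) : Function.Injective (permute σ) :=
  σ.symm.surjective.injective_comp_right

theorem permute_single (σ : Equiv.Perm (Fin (d + 1))) (i : Fin (d + 1)) (a : ℕ) :
    permute σ (Pi.single i a) = Pi.single (σ i) a := by
  funext k
  simp only [permute, Function.comp_apply, Pi.single_apply, Equiv.symm_apply_eq]

theorem permute_corner (σ : Equiv.Perm (Fin (d + 1))) (n : ℕ) (i : Fin (d + 1)) :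
    permute σ (corner n i) = corner n (σ i) := permute_single σ i _

theorem permute_shift (σ : Equiv.Perm (Fin (d + 1))) (n : ℕ) (i : Fin (d + 1))
    (x : Fin (d + 1) → ℕ) : permute σ (shift n i x) = shift n (σ i) (permute σ x) := by
  rw [shift, shift, ← permute_single]
  rfl

theorem map_permute_edges (σ : Equiv.Perm (Fin (d + 1))) (n : ℕ) :
    (edges d n).map (Sym2.map (permute σ)) = edges d n := by
  induction n with
  | zero =>
    rw [edges, Multiset.map_map]
    have h1 : (Sym2.map (permute σ) ∘ Sym2.map (corner 0) : Sym2 (Fin (d + 1)) → _) =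
        Sym2.map (corner 0) ∘ Sym2.map σ := by
      rw [← Sym2.map_comp, ← Sym2.map_comp]
      congr 1
      funext i
      exact permute_corner σ 0 i
    rw [h1, ← Multiset.map_map]
    congr 1
    refine (Multiset.Nodup.ext ((Finset.nodup _).map (Sym2.map.injective σ.injective))
      (Finset.nodup _)).2 fun e => ?_
    rw [Multiset.mem_map]
    constructor
    · rintro ⟨f, hf, rfl⟩
      have : ¬ f.IsDiag := by simpa using hf
      simpa [Sym2.isDiag_map σ.injective] using this
    · intro he
      have he' : ¬ e.IsDiag := by simpa using he
      refine ⟨e.map σ.symm, by simpa [Sym2.isDiag_map σ.symm.injective] using he', ?_⟩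
      rw [Sym2.map_map]
      simp
  | succ n ih =>
    have hs : (edges d (n + 1)).map (Sym2.map (permute σ)) =
        ∑ i, ((edges d n).map (Sym2.map (shift n i))).map (Sym2.map (permute σ)) :=
      map_sum (Multiset.mapAddMonoidHom _) _ _
    rw [hs, edges, ← Equiv.sum_comp σ fun i => (edges d n).map (Sym2.map (shift n i))]
    refine Finset.sum_congr rfl fun i _ => ?_
    conv_rhs => rw [← ih]
    rw [Multiset.map_map, Multiset.map_map, ← Sym2.map_comp, ← Sym2.map_comp]
    congr 2
    funext x
    exact permute_shift σ n i x

/-- Each of the ten pairs of copies identifies one vertex. The count separates the five interiors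
from the 15 corner points, which are indexed by unordered pairs. -/
theorem card_vertices_succ (n : ℕ) : (sierpinskiVertices 4 (n + 1)).card + 10 =
    5 * (sierpinskiVertices 4 n).card := by
  classical
  set I := (sierpinskiVertices 4 n) \ Finset.univ.image (corner n) with hI
  have hIcard : I.card + 5 = (sierpinskiVertices 4 n).card := by
    rw [hI, Finset.card_sdiff_of_subset, Finset.card_image_of_injective _ (corner_injective n),
      Finset.card_univ, Fintype.card_fin]
    · have := Finset.card_le_card (s := Finset.univ.image (corner (d := 4) n))
        (t := sierpinskiVertices 4 n) (by
          intro x hx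
          obtain ⟨i, -, rfl⟩ := Finset.mem_image.1 hx
          exact corner_mem n i)
      rw [Finset.card_image_of_injective _ (corner_injective n), Finset.card_univ,
        Fintype.card_fin] at this
      omega
    · intro x hx
      obtain ⟨i, -, rfl⟩ := Finset.mem_image.1 hx
      exact corner_mem n i
  have hI_mem : ∀ {x}, x ∈ I ↔ x ∈ sierpinskiVertices 4 n ∧ ∀ i, corner n i ≠ x := by
    intro x
    simp [hI]
  set g : Sym2 (Fin 5) → (Fin 5 → ℕ) :=
    Sym2.lift ⟨fun i j => shift n i (corner n j), fun i j => shift_corner_comm n i j⟩ with hg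
  have hginj : Function.Injective g := by
    intro e f h
    induction e with | _ i j =>
    induction f with | _ k l => exact shift_corner_eq_iff.1 h
  have hsplit : sierpinskiVertices 4 (n + 1) =
      (Finset.univ.biUnion fun i => I.image (shift n i)) ∪ Finset.univ.image g := by
    ext x
    rw [mem_vertices_succ]
    simp only [Finset.mem_union, Finset.mem_biUnion, Finset.mem_univ, true_and, Finset.mem_image]
    constructor
    · rintro ⟨i, y, hy, rfl⟩
      by_cases h : ∃ j, corner n j = y
      · obtain ⟨j, rfl⟩ := h
        exact Or.inr ⟨s(i, j), rfl⟩
      · exact Or.inl ⟨i, y, hI_mem.2 ⟨hy, fun j hj => h ⟨j, hj⟩⟩, rfl⟩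
    · rintro (⟨i, y, hy, rfl⟩ | ⟨e, rfl⟩)
      · exact ⟨i, y, (hI_mem.1 hy).1, rfl⟩
      · induction e with | _ i j => exact ⟨i, _, corner_mem n j, rfl⟩
  rw [hsplit, Finset.card_union_of_disjoint, Finset.card_biUnion,
    Finset.card_image_of_injective _ hginj]
  · simp only [Finset.card_image_of_injective _ (shift_injective n _), Finset.sum_const,
      Finset.card_univ, Fintype.card_fin, smul_eq_mul]
    have : Fintype.card (Sym2 (Fin 5)) = 15 := by
      rw [Sym2.card]; rfl
    omega
  · intro i _ j _ hij
    rw [Function.onFun, Finset.disjoint_left]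
    intro x hx hx'
    obtain ⟨y, hy, rfl⟩ := Finset.mem_image.1 hx
    obtain ⟨z, hz, hzy⟩ := Finset.mem_image.1 hx'
    exact (hI_mem.1 hy).2 j (eq_corner_of_shift_eq hij (hI_mem.1 hy).1 hzy.symm).symm
  · rw [Finset.disjoint_left]
    intro x hx hx'
    obtain ⟨i, -, hx⟩ := Finset.mem_biUnion.1 hx
    obtain ⟨y, hy, rfl⟩ := Finset.mem_image.1 hx
    obtain ⟨e, -, he⟩ := Finset.mem_image.1 hx'
    induction e with | _ j k =>
    have he' : shift n j (corner n k) = shift n i y := he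
    by_cases hij : i = j
    · subst hij
      exact (hI_mem.1 hy).2 k (shift_injective n i he')
    · exact (hI_mem.1 hy).2 j (eq_corner_of_shift_eq hij (hI_mem.1 hy).1 he'.symm).symm

theorem two_mul_card_vertices (n : ℕ) : 2 * (sierpinskiVertices 4 n).card = 5 * (5 ^ n + 1) := by
  induction n with
  | zero =>
    have : (sierpinskiVertices 4 0).card = 5 := by
      rw [sierpinskiVertices, Finset.card_image_of_injective]
      · rfl
      · exact corner_injective 0
    rw [this]; norm_num
  | succ n ih =>
    have := card_vertices_succ n
    rw [pow_succ]
    omega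

end SierpinskiGasket

/-! ### Replacing a piece by weighted stars -/

namespace EdgeOp

open Setoid

variable {V W R : Type*} [CommRing R]

/-- Evaluation of a family of decisions, given as a list, with the identifications recorded by
labels. -/
def evalLabels {L : Type*} [DecidableEq L] : List (V × V × R × R) → (V → L) → R
  | [], _ => 1
  | (u, v, a, b) :: t, f =>
    a * evalLabels t f + if f u = f v then 0 else b * evalLabels t (merge f u v)

theorem ev_ker {L : Type*} [DecidableEq L] (l : List (V × V × R × R)) (f : V → L) :
    ev (l.map fun p => (⟨s(p.1, p.2.1), p.2.2.1, p.2.2.2⟩ : EdgeOp V R) : Multiset _) (ker f) =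
      evalLabels l f := by
  induction l generalizing f with
  | nil => rfl
  | cons p t ih =>
    obtain ⟨u, v, a, b⟩ := p
    rw [List.map_cons, ← Multiset.cons_coe, ev_cons_apply, ih, ker_glue, ih, evalLabels]
    simp only [joins_mk, ker_def]

/-- The edges from a hub `h` to the points `g b`, with weight `q` each after centering. -/
def star (g : Fin 5 → V) (h : V) (q : R) : Multiset (EdgeOp V R) :=
  ∑ b : Fin 5, {⟨s(h, g b), 1 - q, q⟩}

theorem star_map (g : Fin 5 → V) (h : V) (q : R) (f : V → W) :
    (star g h q).map (EdgeOp.map f) = star (f ∘ g) (f h) q := by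
  exact map_sum (Multiset.mapAddMonoidHom (EdgeOp.map f : EdgeOp V R → EdgeOp W R))
    (fun b : Fin 5 => ({⟨s(h, g b), 1 - q, q⟩} : Multiset (EdgeOp V R))) Finset.univ

theorem mem_star {g : Fin 5 → V} {h : V} {q : R} {o : EdgeOp V R} (ho : o ∈ star g h q) :
    ∃ b, o.edge = s(h, g b) := by
  simp only [star, Multiset.mem_sum, Finset.mem_univ, true_and, Multiset.mem_singleton] at ho
  obtain ⟨b, rfl⟩ := ho
  exact ⟨b, rfl⟩

theorem star_comp_perm (g : Fin 5 → V) (h : V) (q : R) (σ : Equiv.Perm (Fin 5)) :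
    star (g ∘ σ) h q = star g h q :=
  Equiv.sum_comp σ fun b => ({(⟨s(h, g b), 1 - q, q⟩ : EdgeOp V R)} : Multiset (EdgeOp V R))

theorem isSymmetricFourPoint_star (q : R) :
    IsSymmetricFourPoint (boundary (star some none q) (some : Fin 5 → Option (Fin 5))) := by
  refine isSymmetricFourPoint_boundary (Option.some_injective _) fun σ =>
    ⟨Option.map σ, Option.map_injective σ.injective, fun i => rfl, ?_⟩
  rw [star_map]
  exact star_comp_perm some none q σ

theorem extend_some_block (k : ℕ) : (block k).extend (some : Fin 5 → Option (Fin 5)) =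
    ker fun x : Option (Fin 5) => x.elim 5 fun i => if (i : ℕ) < k then 0 else (i : ℕ) := by
  have hnone : ∀ i : Fin 5, some i ≠ none := fun i => Option.some_ne_none i
  ext x y
  rcases x with _ | i
  · rw [(extend_isolated _ hnone).rel_iff, ker_def]
    rcases y with _ | j
    · simp
    · have : (5 : ℕ) ≠ if (j : ℕ) < k then 0 else (j : ℕ) := by split_ifs <;> omega
      simpa using this
  · rcases y with _ | j
    · rw [(extend_isolated _ hnone).rel_iff', ker_def]
      have : (if (i : ℕ) < k then 0 else (i : ℕ)) ≠ 5 := by split_ifs <;> omega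
      simpa using this
    · rw [extend_rel (Option.some_injective _)]
      rfl

/-- The k+1 edges to the block become parallel, so at most one is taken, giving (1-q)^(k+1) + (k+1)
q (1-q)^k. Every other edge contributes (1-q) + q = 1; this is the purpose of the centering. -/
theorem boundary_star_block (q : R) (k : ℕ) (hk : k < 5) :
    boundary (star some none q) (some : Fin 5 → Option (Fin 5)) (block (k + 1)) =
      (1 - q) ^ k * (1 + k * q) := by
  have hs : star some none q = (([0, 1, 2, 3, 4] : List (Fin 5)).map
      (fun b => ((none, some b, 1 - q, q) : Option (Fin 5) × Option (Fin 5) × R × R))).map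
      (fun p => (⟨s(p.1, p.2.1), p.2.2.1, p.2.2.2⟩ : EdgeOp (Option (Fin 5)) R)) := by
    rw [star, Fin.sum_univ_five]
    rfl
  rw [boundary, extend_some_block, hs, ev_ker]
  simp only [List.map_cons, List.map_nil, evalLabels]
  interval_cases k <;> simp [merge] <;> ring

theorem ev_star_eq_boundary {g : Fin 5 → W} {h : W} (hgh : ∀ b, g b ≠ h) (q : R) {r : Setoid W}
    (hr : r.Isolated h) :
    ev (star g h q) r = boundary (star some none q) (some : Fin 5 → Option (Fin 5)) (r.comap g) := by
  have e := star_map (some : Fin 5 → Option (Fin 5)) none q fun x => x.elim h g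
  have e' : (fun x : Option (Fin 5) => x.elim h g) ∘ some = g := rfl
  rw [e'] at e
  rw [show star g h q = star g (Option.elim none h g) q from rfl, ← e,
    ev_map_eq_boundary (Option.some_injective _) (S := Set.univ) (by simp) _ r]
  · rfl
  · rintro (_ | b) _ hx y hy
    · rcases y with _ | b
      · rfl
      · exact absurd (hr _ hy) (hgh b)
    · exact absurd rfl (hx b)

/-- Two decisions about edges that share an isolated endpoint amount to one decision about the
edge between the other endpoints. -/
theorem ev_pair_of_isolated {r : Setoid V} {g u v : V} (hg : r.Isolated g) (hu : u ≠ g)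
    (hv : v ≠ g) (a a' b b' : R) :
    ev {⟨s(u, g), a, a'⟩, ⟨s(v, g), b, b'⟩} r =
      ev {⟨s(u, v), a * b + a * b' + a' * b, a' * b'⟩} r := by
  have h1 : ¬ r u g := fun h => hu (hg u (r.symm' h))
  have h2 : ¬ r v g := fun h => hv (hg v (r.symm' h))
  have hvu : r v u ↔ r u v := r.comm'
  simp only [Multiset.insert_eq_cons, ← Multiset.cons_zero, ev_cons_apply, ev_zero, joins_mk,
    glue_rel]
  by_cases huv : r u v
  · simp [h1, h2, huv, hvu, glue_rel]; ring
  · simp [h1, h2, huv, hvu, glue_rel]; ring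

theorem ev_single_of_isolated {r : Setoid V} {g u : V} (hg : r.Isolated g) (hu : u ≠ g)
    (a a' : R) : ev {⟨s(u, g), a, a'⟩} r = a + a' := by
  have h1 : ¬ r u g := fun h => hu (hg u (r.symm' h))
  simp [← Multiset.cons_zero, ev_cons_apply, h1]

/-- Elimination of isolated points with a finite number of disjoint gadgets. -/
theorem ev_add_sum_congr {κ : Type*} (s : Finset κ) (g : κ → V) (Y Y' : κ → Multiset (EdgeOp V R))
    (hY : ∀ k ∈ s, ∀ r : Setoid V, r.Isolated (g k) → ev (Y k) r = ev (Y' k) r)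
    (hYg : ∀ k ∈ s, ∀ l ∈ s, k ≠ l → ∀ o ∈ Y l, g k ∉ o.edge)
    (hYg' : ∀ k ∈ s, ∀ l ∈ s, ∀ o ∈ Y' l, g k ∉ o.edge) (X : Multiset (EdgeOp V R))
    (hX : ∀ k ∈ s, ∀ o ∈ X, g k ∉ o.edge) :
    ev (X + ∑ k ∈ s, Y k) ⊥ = ev (X + ∑ k ∈ s, Y' k) ⊥ := by
  classical
  induction s using Finset.induction_on generalizing X with
  | empty => rfl
  | insert k s hk ih =>
    rw [Finset.sum_insert hk, Finset.sum_insert hk]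
    have e1 : X + (Y k + ∑ l ∈ s, Y l) = (X + ∑ l ∈ s, Y l) + Y k := by abel
    have e2 : (X + ∑ l ∈ s, Y l) + Y' k = (X + Y' k) + ∑ l ∈ s, Y l := by abel
    have e3 : X + (Y' k + ∑ l ∈ s, Y' l) = (X + Y' k) + ∑ l ∈ s, Y' l := by abel
    have hks : k ∈ insert k s := Finset.mem_insert_self _ _
    have hs : ∀ l ∈ s, l ∈ insert k s := fun l => Finset.mem_insert_of_mem
    rw [e1, ev_add_congr_one (Y := Y' k) (Z := Y k) 1 (fun r => r.Isolated (g k))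
      (fun r hr => by rw [one_mul, hY k hks r hr]) _ ?_ _ (isolated_bot _), one_mul, e2, e3]
    · refine ih (fun l hl => hY l (hs l hl)) (fun l hl m hm => hYg l (hs l hl) m (hs m hm))
        (fun l hl m hm => hYg' l (hs l hl) m (hs m hm)) _ fun l hl o ho => ?_
      rcases Multiset.mem_add.1 ho with ho | ho
      · exact hX l (hs l hl) o ho
      · exact hYg' l (hs l hl) k hks o ho
    · intro o ho r hr
      apply hr.glue
      rcases Multiset.mem_add.1 ho with ho | ho
      · exact hX k hks o ho
      · obtain ⟨l, hl, ho⟩ := Multiset.mem_sum.1 ho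
        exact hYg k hks l (hs l hl) (fun h => hk (h ▸ hl)) o ho

end EdgeOp

namespace SierpinskiGasket

open EdgeOp Setoid

/-- The number of forests at stage `n` that remain forests when the first `k` outmost vertices are
identified. -/
noncomputable def blockCount (n k : ℕ) : ℚ :=
  boundary (count ℚ (edges 4 n)) (corner n) (block k)

theorem isSymmetricFourPoint_gasket (n : ℕ) :
    IsSymmetricFourPoint (boundary (count ℚ (edges 4 n)) (corner n)) := by
  refine isSymmetricFourPoint_boundary (corner_injective n) fun σ =>
    ⟨permute σ, permute_injective σ, permute_corner σ n, ?_⟩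
  rw [← count_map, map_permute_edges]

/-- Weights on the points `0, …, 5` represent stage `n` if they turn the numbers of forests of
stars into those of stage `n`. -/
def Represents (ω : Fin 6 → ℚ) (n : ℕ) : Prop :=
  ∀ k : ℕ, k < 5 → ∑ a, ω a * ((1 - (a : ℚ)) ^ k * (1 + k * a)) = blockCount n (k + 1)

/-- Both sides are symmetric and satisfy the four-point relation, so the agreement on single blocks
suffices. -/
theorem Represents.boundary_eq {ω : Fin 6 → ℚ} {n : ℕ} (h : Represents ω n) :
    boundary (count ℚ (edges 4 n)) (corner n) = fun s => ∑ a, ω a *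
      boundary (star some none ((a : ℕ) : ℚ)) (some : Fin 5 → Option (Fin 5)) s := by
  refine (isSymmetricFourPoint_gasket n).eq_of_block
    (isSymmetricFourPoint_sum _ _ _ fun a => isSymmetricFourPoint_star _) fun k hk => ?_
  obtain ⟨hk1, hk5⟩ := Finset.mem_Icc.1 hk
  obtain ⟨j, rfl⟩ : ∃ j, k = j + 1 := ⟨k - 1, by omega⟩
  have := h j (by omega)
  rw [blockCount] at this
  rw [← this]
  exact Finset.sum_congr rfl fun a _ => by rw [boundary_star_block _ j (by omega)]

/-- A copy of stage `n` may be replaced by a weighted sum of stars. -/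
theorem Represents.ev_eq {ω : Fin 6 → ℚ} {n : ℕ} (hω : Represents ω n) {W : Type*}
    (f : (Fin 5 → ℕ) → W) (h : W) {r : Setoid W}
    (hf : ∀ x ∈ sierpinskiVertices 4 n, (∀ i, corner n i ≠ x) → ∀ y, r (f x) (f y) → y = x)
    (hh : r.Isolated h) (hfh : ∀ b, f (corner n b) ≠ h) :
    ev ((count ℚ (edges 4 n)).map (EdgeOp.map f)) r =
      ∑ a, ω a * ev (star (fun b => f (corner n b)) h ((a : ℕ) : ℚ)) r := by
  rw [ev_map_eq_boundary (corner_injective n) (S := {x | x ∈ sierpinskiVertices 4 n})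
    (fun o ho x hx => mem_vertices_of_mem_edges (mem_count ho) hx) f r hf, hω.boundary_eq]
  refine Finset.sum_congr rfl fun a _ => ?_
  rw [ev_star_eq_boundary hfh _ hh]
  rfl

end SierpinskiGasket

/-! ### The recursion for the moments -/

namespace SierpinskiGasket

open EdgeOp Setoid

/-- The vertices of the gasket together with additional hubs. -/
abbrev Extended : Type := (Fin 5 → ℕ) ⊕ Fin 6

/-- Centered edges from the hub `5` to the first `t` outmost vertices at stage `n`. -/
def centered (t n : ℕ) : Multiset (EdgeOp Extended ℚ) :=
  ∑ b : Fin 5, if (b : ℕ) < t then {⟨s(Sum.inr 5, Sum.inl (corner n b)), -1, 1⟩} else 0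

theorem mem_centered {t n : ℕ} {o : EdgeOp Extended ℚ} (ho : o ∈ centered t n) :
    ∃ b : Fin 5, o.edge = s(Sum.inr 5, Sum.inl (corner n b)) := by
  obtain ⟨b, -, hb⟩ := Multiset.mem_sum.1 ho
  split_ifs at hb
  · rw [Multiset.mem_singleton] at hb
    exact ⟨b, by rw [hb]⟩
  · simp at hb

/-- The signed number of forests at stage `n` with centered edges at the first `t` corners. -/
noncomputable def moment (n t : ℕ) : ℚ :=
  ev (centered t n + (count ℚ (edges 4 n)).map (EdgeOp.map Sum.inl)) ⊥

theorem moment_zero (n : ℕ) : moment n 0 = ev (count ℚ (edges 4 n)) ⊥ := by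
  have : centered 0 n = 0 := by simp [centered]
  rw [moment, this, zero_add, ev_map]
  congr 1
  ext x y
  exact Sum.inl_injective.eq_iff

/-- At most one of t parallel edges is taken: (-q)^t + t q (-q)^(t-1). The factor 1-t is why the
first moment stays invisible. -/
theorem ev_parallel (q : ℚ) (t : ℕ) (ht : t ≤ 5) :
    ev (∑ b : Fin 5, if (b : ℕ) < t then
      {(⟨s(Sum.inr 5, Sum.inr 0), -q, q⟩ : EdgeOp Extended ℚ)} else 0) ⊥ =
      (-1) ^ t * (1 - t) * q ^ t := by
  have h1 : ((⊥ : Setoid Extended).glue s(Sum.inr 5, Sum.inr 0)) (Sum.inr 5) (Sum.inr 0) :=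
    glue_rel.2 (Or.inr (Or.inl ⟨refl' _ _, refl' _ _⟩))
  rw [Fin.sum_univ_five]
  interval_cases t <;>
    simp [← Multiset.cons_zero, ev_cons_apply, h1] <;> ring

/-- With stage n replaced by stars, eliminating a corner that has edges to both hubs leaves an edge
between the hubs with weights -q and q. The weights -1 and 1 of the centered edges are chosen so
that both are multiples of q and a pure power q^t results. -/
theorem moment_eq {ω : Fin 6 → ℚ} {n : ℕ} (hω : Represents ω n) {t : ℕ} (ht : t ≤ 5) :
    moment n t = (-1) ^ t * (1 - t) * ∑ a : Fin 6, ω a * ((a : ℕ) : ℚ) ^ t := by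
  have hne : ∀ (x : Fin 5 → ℕ) (k : Fin 6), (Sum.inl x : Extended) ≠ Sum.inr k := by simp
  rw [moment, ev_add_congr Finset.univ ω
    (fun a => EdgeOp.star (fun b => (Sum.inl (corner n b) : Extended)) (Sum.inr 0) ((a : ℕ) : ℚ)) _
    (fun r => (∀ x, (∀ b, corner n b ≠ x) → r.Isolated (Sum.inl x)) ∧ r.Isolated (Sum.inr 0))
    (fun r hr => hω.ev_eq Sum.inl (Sum.inr 0)
      (fun x _ hx y hy => Sum.inl_injective (hr.1 x hx _ hy)) hr.2 fun b => hne _ _) _ ?_ _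
    ⟨fun x _ => isolated_bot _, isolated_bot _⟩, Finset.mul_sum]
  · refine Finset.sum_congr rfl fun a _ => ?_
    set q : ℚ := ((a : ℕ) : ℚ)
    have key := ev_add_sum_congr (V := Extended) (Finset.univ : Finset (Fin 5))
      (fun b => Sum.inl (corner n b))
      (fun b => (if (b : ℕ) < t then {⟨s(Sum.inr 5, Sum.inl (corner n b)), -1, 1⟩} else 0) +
        {⟨s(Sum.inr 0, Sum.inl (corner n b)), 1 - q, q⟩})
      (fun b => if (b : ℕ) < t then {⟨s(Sum.inr 5, Sum.inr 0), -q, q⟩} else 0) ?_ ?_ ?_ 0 (by simp)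
    · rw [zero_add, zero_add, ev_parallel q t ht, Finset.sum_add_distrib] at key
      rw [centered, EdgeOp.star, key]
      ring
    · intro b _ r hr
      by_cases hb : (b : ℕ) < t
      · simp only [hb, if_true, Multiset.singleton_add]
        rw [← Multiset.insert_eq_cons, ev_pair_of_isolated hr (by simp) (by simp)]
        congr 3 <;> ring
      · simp only [hb, if_false, zero_add]
        rw [ev_single_of_isolated hr (by simp), ev_zero]
        ring
    · intro b _ c _ hbc o ho
      have hbc' : corner n b ≠ corner n c := fun h => hbc (corner_injective n h)
      rcases Multiset.mem_add.1 ho with ho | ho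
      · split_ifs at ho
        · rw [Multiset.mem_singleton] at ho
          subst ho
          simp [hbc']
        · simp at ho
      · rw [Multiset.mem_singleton] at ho
        subst ho
        simp [hbc']
    · intro b _ c _ o ho
      split_ifs at ho
      · rw [Multiset.mem_singleton] at ho
        subst ho
        simp
      · simp at ho
  · rintro o ho r ⟨h1, h2⟩
    obtain ⟨b, hb⟩ := mem_centered ho
    rw [hb]
    exact ⟨fun x hx => (h1 x hx).glue (by simpa using fun h => hx b h.symm), h2.glue (by simp)⟩

/-- `X` touches neither the interior of the copy `i` of stage `n` nor the hub `i`. -/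
def Avoids (n : ℕ) (i : Fin 5) (X : Multiset (EdgeOp Extended ℚ)) : Prop :=
  ∀ o ∈ X, (∀ x ∈ sierpinskiVertices 4 n, (∀ b, corner n b ≠ x) →
    Sum.inl (shift n i x) ∉ o.edge) ∧ Sum.inr i.castSucc ∉ o.edge

theorem Avoids.add {n : ℕ} {i : Fin 5} {X Y : Multiset (EdgeOp Extended ℚ)} (hX : Avoids n i X)
    (hY : Avoids n i Y) : Avoids n i (X + Y) := by
  intro o ho
  rcases Multiset.mem_add.1 ho with ho | ho
  · exact hX o ho
  · exact hY o ho

/-- The copy `i` of stage `n` inside stage `n + 1`. -/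
def copy (n : ℕ) (i : Fin 5) : Multiset (EdgeOp Extended ℚ) :=
  (count ℚ (edges 4 n)).map (EdgeOp.map fun x => Sum.inl (shift n i x))

/-- The star that replaces the copy `i` of stage `n`. -/
def copyStar (n : ℕ) (i : Fin 5) (q : ℚ) : Multiset (EdgeOp Extended ℚ) :=
  EdgeOp.star (fun b => Sum.inl (shift n i (corner n b))) (Sum.inr i.castSucc) q

theorem shift_ne_shift_corner {n : ℕ} {i j b : Fin 5} {x : Fin 5 → ℕ}
    (hx : x ∈ sierpinskiVertices 4 n) (hb : ∀ b, corner n b ≠ x) :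
    shift n i x ≠ shift n j (corner n b) := by
  intro h
  by_cases hij : i = j
  · subst hij
    exact hb b (shift_injective n i h).symm
  · exact hb j (eq_corner_of_shift_eq hij hx h).symm

theorem avoids_centered (n t : ℕ) (i : Fin 5) : Avoids n i (centered t (n + 1)) := by
  intro o ho
  obtain ⟨b, hb⟩ := mem_centered ho
  rw [hb]
  refine ⟨fun x hx hx' => ?_, ?_⟩
  · have := shift_ne_shift_corner (i := i) (j := b) (b := b) hx hx'
    rw [shift_corner_self] at this
    simpa using this
  · have : i.castSucc ≠ (5 : Fin 6) := (Fin.castSucc_lt_last i).ne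
    simpa using this

theorem avoids_copyStar {n : ℕ} {i j : Fin 5} (hij : i ≠ j) (q : ℚ) :
    Avoids n i (copyStar n j q) := by
  intro o ho
  obtain ⟨b, hb⟩ := mem_star ho
  rw [hb]
  refine ⟨fun x hx hx' => ?_, ?_⟩
  · simpa using shift_ne_shift_corner (i := i) (j := j) (b := b) hx hx'
  · simpa using hij

theorem avoids_copy {n : ℕ} {i j : Fin 5} (hij : i ≠ j) : Avoids n i (copy n j) := by
  intro o ho
  obtain ⟨p, hp, rfl⟩ := Multiset.mem_map.1 ho
  refine ⟨fun x hx hx' h => ?_, fun h => ?_⟩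
  · obtain ⟨y, -, hy⟩ := Sym2.mem_map.1 h
    exact hx' j (eq_corner_of_shift_eq hij hx (Sum.inl_injective hy).symm).symm
  · obtain ⟨y, -, hy⟩ := Sym2.mem_map.1 h
    simp at hy

theorem Represents.replace_copy {ω : Fin 6 → ℚ} {n : ℕ} (hω : Represents ω n) (i : Fin 5)
    {X : Multiset (EdgeOp Extended ℚ)} (hX : Avoids n i X) :
    ev (X + copy n i) ⊥ = ∑ a : Fin 6, ω a * ev (X + copyStar n i ((a : ℕ) : ℚ)) ⊥ := by
  refine ev_add_congr Finset.univ ω (fun a => copyStar n i ((a : ℕ) : ℚ)) _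
    (fun r => (∀ x ∈ sierpinskiVertices 4 n, (∀ b, corner n b ≠ x) →
      r.Isolated (Sum.inl (shift n i x))) ∧ r.Isolated (Sum.inr i.castSucc))
    (fun r hr => hω.ev_eq (fun x => Sum.inl (shift n i x)) (Sum.inr i.castSucc)
      (fun x hxv hx y hy => shift_injective n i (Sum.inl_injective (hr.1 x hxv hx _ hy))) hr.2
      fun b => by simp) _ ?_ _ ⟨fun x _ _ => isolated_bot _, isolated_bot _⟩
  rintro o ho r ⟨h1, h2⟩
  exact ⟨fun x hxv hx => (h1 x hxv hx).glue ((hX o ho).1 x hxv hx), h2.glue (hX o ho).2⟩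

theorem sum_pi_succ {α : Type*} [Fintype α] {m : ℕ} (g : (Fin (m + 1) → α) → ℚ) :
    ∑ q, g q = ∑ a, ∑ q : Fin m → α, g (Fin.cons a q) := by
  rw [← (Fin.consEquiv fun _ => α).sum_comp, Fintype.sum_prod_type]
  rfl

theorem sum_pi_five {α : Type*} [Fintype α] (g : (Fin 5 → α) → ℚ) :
    ∑ q : Fin 5 → α, g q = ∑ a, ∑ b, ∑ c, ∑ d, ∑ e, g ![a, b, c, d, e] := by
  simp only [sum_pi_succ, Fintype.sum_unique]
  refine Finset.sum_congr rfl fun a _ => Finset.sum_congr rfl fun b _ => Finset.sum_congr rfl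
    fun c _ => Finset.sum_congr rfl fun d _ => Finset.sum_congr rfl fun e _ => congrArg g ?_
  ext i
  fin_cases i <;> rfl

theorem edges_succ_map_inl (n : ℕ) :
    (count ℚ (edges 4 (n + 1))).map (EdgeOp.map (Sum.inl : _ → Extended)) = ∑ i, copy n i := by
  rw [edges, count_sum]
  refine (map_sum (Multiset.mapAddMonoidHom (EdgeOp.map Sum.inl)) _ _).trans
    (Finset.sum_congr rfl fun i _ => ?_)
  rw [count_map, Multiset.coe_mapAddMonoidHom, Multiset.map_map, copy]
  refine Multiset.map_congr rfl fun o _ => ?_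
  simp only [Function.comp_apply, EdgeOp.map, Sym2.map_map]

/-- The copies are replaced one at a time. At each step the remaining copies, the stars already
inserted and the centered edges avoid the interior and the hub of the copy in question. -/
theorem moment_succ_eq_sum_stars {ω : Fin 6 → ℚ} {n : ℕ} (hω : Represents ω n) (t : ℕ) :
    moment (n + 1) t = ∑ q : Fin 5 → Fin 6, (∏ i, ω (q i)) *
      ev (centered t (n + 1) + ∑ i, copyStar n i ((q i : ℕ) : ℚ)) ⊥ := by
  have hC := avoids_centered n t
  rw [moment, edges_succ_map_inl, Fin.sum_univ_five, sum_pi_five]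
  set C := centered t (n + 1)
  have hS := fun (i j : Fin 5) (h : i ≠ j) (a : Fin 6) => avoids_copyStar (n := n) h ((a : ℕ) : ℚ)
  have hc := fun (i j : Fin 5) (h : i ≠ j) => avoids_copy (n := n) h
  have e0 : C + (copy n 0 + copy n 1 + copy n 2 + copy n 3 + copy n 4) =
      (C + copy n 1 + copy n 2 + copy n 3 + copy n 4) + copy n 0 := by abel
  rw [e0, hω.replace_copy 0 (((((hC 0).add (hc 0 1 (by decide))).add (hc 0 2 (by decide))).add
    (hc 0 3 (by decide))).add (hc 0 4 (by decide)))]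
  refine Finset.sum_congr rfl fun a _ => ?_
  have e1 : C + copy n 1 + copy n 2 + copy n 3 + copy n 4 + copyStar n 0 ((a : ℕ) : ℚ) =
    (C + copyStar n 0 ((a : ℕ) : ℚ) + copy n 2 + copy n 3 + copy n 4) + copy n 1 := by abel
  rw [e1, hω.replace_copy 1 (((((hC 1).add (hS 1 0 (by decide) a)).add (hc 1 2 (by decide))).add
    (hc 1 3 (by decide))).add (hc 1 4 (by decide))), Finset.mul_sum]
  refine Finset.sum_congr rfl fun b _ => ?_
  have e2 : C + copyStar n 0 ((a : ℕ) : ℚ) + copy n 2 + copy n 3 + copy n 4 +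
      copyStar n 1 ((b : ℕ) : ℚ) = (C + copyStar n 0 ((a : ℕ) : ℚ) + copyStar n 1 ((b : ℕ) : ℚ) +
        copy n 3 + copy n 4) + copy n 2 := by abel
  rw [e2, hω.replace_copy 2 (((((hC 2).add (hS 2 0 (by decide) a)).add (hS 2 1 (by decide) b)).add
    (hc 2 3 (by decide))).add (hc 2 4 (by decide))), Finset.mul_sum, Finset.mul_sum]
  refine Finset.sum_congr rfl fun c _ => ?_
  have e3 : C + copyStar n 0 ((a : ℕ) : ℚ) + copyStar n 1 ((b : ℕ) : ℚ) + copy n 3 + copy n 4 +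
      copyStar n 2 ((c : ℕ) : ℚ) = (C + copyStar n 0 ((a : ℕ) : ℚ) + copyStar n 1 ((b : ℕ) : ℚ) +
        copyStar n 2 ((c : ℕ) : ℚ) + copy n 4) + copy n 3 := by abel
  rw [e3, hω.replace_copy 3 (((((hC 3).add (hS 3 0 (by decide) a)).add (hS 3 1 (by decide) b)).add
    (hS 3 2 (by decide) c)).add (hc 3 4 (by decide))), Finset.mul_sum, Finset.mul_sum,
    Finset.mul_sum]
  refine Finset.sum_congr rfl fun d _ => ?_
  have e4 : C + copyStar n 0 ((a : ℕ) : ℚ) + copyStar n 1 ((b : ℕ) : ℚ) +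
      copyStar n 2 ((c : ℕ) : ℚ) + copy n 4 + copyStar n 3 ((d : ℕ) : ℚ) =
      (C + copyStar n 0 ((a : ℕ) : ℚ) + copyStar n 1 ((b : ℕ) : ℚ) + copyStar n 2 ((c : ℕ) : ℚ) +
        copyStar n 3 ((d : ℕ) : ℚ)) + copy n 4 := by abel
  rw [e4, hω.replace_copy 4 (((((hC 4).add (hS 4 0 (by decide) a)).add (hS 4 1 (by decide) b)).add
    (hS 4 2 (by decide) c)).add (hS 4 3 (by decide) d)), Finset.mul_sum, Finset.mul_sum,
    Finset.mul_sum, Finset.mul_sum]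
  refine Finset.sum_congr rfl fun e _ => ?_
  rw [Fin.sum_univ_five, Fin.prod_univ_five]
  have e5 : C + copyStar n 0 ((a : ℕ) : ℚ) + copyStar n 1 ((b : ℕ) : ℚ) +
      copyStar n 2 ((c : ℕ) : ℚ) + copyStar n 3 ((d : ℕ) : ℚ) + copyStar n 4 ((e : ℕ) : ℚ) =
      C + (copyStar n 0 ((a : ℕ) : ℚ) + copyStar n 1 ((b : ℕ) : ℚ) + copyStar n 2 ((c : ℕ) : ℚ) +
        copyStar n 3 ((d : ℕ) : ℚ) + copyStar n 4 ((e : ℕ) : ℚ)) := by abel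
  rw [e5]
  simp only [Matrix.cons_val]
  ring

/-- Regroups edges by the vertex at which they end: corner j of copy i is corner i of copy j, so
vertices correspond to pairs i ≤ j. -/
theorem sum_add_sum_sum_fin_five {M : Type*} [AddCommMonoid M] (D : Fin 5 → M)
    (l : Fin 5 → Fin 5 → M) :
    ∑ i, D i + ∑ i, ∑ j, l i j =
      ∑ k ∈ (Finset.univ : Finset (Fin 5 × Fin 5)).filter (fun k => k.1 ≤ k.2),
        if k.1 = k.2 then D k.1 + l k.1 k.1 else l k.1 k.2 + l k.2 k.1 := by
  rw [Finset.sum_filter, Fintype.sum_prod_type]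
  simp only [Fin.sum_univ_five]
  simp
  abel

/-- The system of hubs that remains after the elimination of all vertices. -/
def hubEdges (t : ℕ) (q : Fin 5 → ℚ) : Multiset (EdgeOp (Fin 6) ℚ) :=
  ∑ k ∈ (Finset.univ : Finset (Fin 5 × Fin 5)).filter (fun k => k.1 ≤ k.2),
    if k.1 = k.2 then
      if (k.1 : ℕ) < t then {⟨s(5, k.1.castSucc), -q k.1, q k.1⟩} else 0
    else {⟨s(k.1.castSucc, k.2.castSucc), 1 - q k.1 * q k.2, q k.1 * q k.2⟩}

/-- A vertex shared by the copies i and j joins their two hubs; it is taken with weight q_i q_j and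
left out with weight 1 - q_i q_j. An outmost vertex becomes an edge to the hub 5, or drops out with
weight (1-q) + q = 1. -/
theorem ev_stars_eq_ev_hubEdges (n t : ℕ) (q : Fin 5 → ℚ) :
    ev (centered t (n + 1) + ∑ i, copyStar n i (q i)) ⊥ = ev (hubEdges t q) ⊥ := by
  have h1 : ev (hubEdges t q) ⊥ =
      ev ((hubEdges t q).map (EdgeOp.map (Sum.inr : _ → Extended))) ⊥ := by
    rw [ev_map]
    congr 1
    ext x y
    exact Sum.inr_injective.eq_iff.symm
  have h2 : (hubEdges t q).map (EdgeOp.map (Sum.inr : _ → Extended)) =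
      ∑ k ∈ (Finset.univ : Finset (Fin 5 × Fin 5)).filter (fun k => k.1 ≤ k.2),
        if k.1 = k.2 then
          if (k.1 : ℕ) < t then {⟨s(Sum.inr 5, Sum.inr k.1.castSucc), -q k.1, q k.1⟩} else 0
        else {⟨s(Sum.inr k.1.castSucc, Sum.inr k.2.castSucc), 1 - q k.1 * q k.2,
          q k.1 * q k.2⟩} := by
    refine (map_sum (Multiset.mapAddMonoidHom (EdgeOp.map Sum.inr)) _ _).trans
      (Finset.sum_congr rfl fun k _ => ?_)
    rw [Multiset.coe_mapAddMonoidHom]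
    split_ifs <;> simp
  rw [h1, h2]
  simp only [centered, copyStar, EdgeOp.star]
  rw [sum_add_sum_sum_fin_five]
  have key := ev_add_sum_congr (V := Extended)
    ((Finset.univ : Finset (Fin 5 × Fin 5)).filter (fun k => k.1 ≤ k.2))
    (fun k => Sum.inl (shift n k.1 (corner n k.2))) 
    (fun k => if k.1 = k.2 then
          (if (k.1 : ℕ) < t then
            {⟨s(Sum.inr 5, Sum.inl (corner (n + 1) k.1)), -1, 1⟩} else 0) +
            {⟨s(Sum.inr k.1.castSucc, Sum.inl (shift n k.1 (corner n k.1))), 1 - q k.1, q k.1⟩}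
        else
          {⟨s(Sum.inr k.1.castSucc, Sum.inl (shift n k.1 (corner n k.2))), 1 - q k.1, q k.1⟩} +
            {⟨s(Sum.inr k.2.castSucc, Sum.inl (shift n k.2 (corner n k.1))), 1 - q k.2, q k.2⟩})
    (fun k => if k.1 = k.2 then
          if (k.1 : ℕ) < t then {⟨s(Sum.inr 5, Sum.inr k.1.castSucc), -q k.1, q k.1⟩} else 0
        else {⟨s(Sum.inr k.1.castSucc, Sum.inr k.2.castSucc), 1 - q k.1 * q k.2,
          q k.1 * q k.2⟩}) ?_ ?_ ?_ 0 (by simp)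
  · simpa only [zero_add] using key
  · rintro ⟨i, j⟩ _ r hr
    by_cases hij : i = j
    · subst hij
      simp only [if_true]
      simp only [shift_corner_self] at hr ⊢
      by_cases hi : (i : ℕ) < t
      · simp only [hi, if_true, Multiset.singleton_add]
        rw [← Multiset.insert_eq_cons, ev_pair_of_isolated hr (by simp) (by simp)]
        congr 3 <;> ring
      · simp only [hi, if_false, zero_add]
        rw [ev_single_of_isolated hr (by simp), ev_zero]
        ring
    · simp only [hij, if_false, Multiset.singleton_add]
      rw [shift_corner_comm n j i, ← Multiset.insert_eq_cons,
        ev_pair_of_isolated hr (by simp) (by simp)]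
      congr 3; ring
  · rintro ⟨i, j⟩ hij ⟨k, l⟩ hkl hne o ho
    have hij' : i ≤ j := by simpa using hij
    have hkl' : k ≤ l := by simpa using hkl
    have hs : shift n i (corner n j) ≠ shift n k (corner n l) := by
      intro h
      rcases Sym2.eq_iff.1 (shift_corner_eq_iff.1 h) with ⟨rfl, rfl⟩ | ⟨rfl, rfl⟩
      · exact hne rfl
      · obtain rfl := le_antisymm hij' hkl'
        exact hne rfl
    have hs' : shift n i (corner n j) ≠ shift n l (corner n k) := by
      rw [shift_corner_comm n l k]; exact hs
    dsimp only at ho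
    split_ifs at ho with h h'
    · subst h
      rw [← shift_corner_self] at ho
      simp only [Multiset.singleton_add, Multiset.mem_cons, Multiset.mem_singleton] at ho
      rcases ho with rfl | rfl <;> simp [hs]
    · subst h
      simp only [zero_add, Multiset.mem_singleton] at ho
      subst ho
      simp [hs]
    · simp only [Multiset.singleton_add, Multiset.mem_cons, Multiset.mem_singleton] at ho
      rcases ho with rfl | rfl <;> simp [hs, hs']
  · rintro ⟨i, j⟩ _ ⟨k, l⟩ _ o ho
    dsimp only at ho
    split_ifs at ho
    · rw [Multiset.mem_singleton] at ho
      subst ho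
      simp
    · simp at ho
    · rw [Multiset.mem_singleton] at ho
      subst ho
      simp

theorem moment_succ_eq {ω : Fin 6 → ℚ} {n : ℕ} (hω : Represents ω n) (t : ℕ) :
    moment (n + 1) t = ∑ q : Fin 5 → Fin 6, (∏ i, ω (q i)) *
      ev (hubEdges t fun i => ((q i : ℕ) : ℚ)) ⊥ := by
  rw [moment_succ_eq_sum_stars hω]
  exact Finset.sum_congr rfl fun q _ => by
    rw [ev_stars_eq_ev_hubEdges n t fun i => ((q i : ℕ) : ℚ)]

end SierpinskiGasket

/-! ### Expansion of the hub system into monomials -/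

namespace EdgeOp

open Setoid

/-- Integer coefficients indexed by the subsets of a list of edges. -/
def SubsetCoeff : List (ℕ × ℕ) → Type
  | [] => ℤ
  | _ :: es => SubsetCoeff es × SubsetCoeff es

namespace SubsetCoeff

/-- The only coefficient, when there is no edge. -/
def value (c : SubsetCoeff []) : ℤ := c

/-- A single coefficient. -/
def const (c : ℤ) : SubsetCoeff [] := c

variable {e : ℕ × ℕ} {es : List (ℕ × ℕ)}

/-- The coefficients of the subsets without the first edge. -/
def fst (c : SubsetCoeff (e :: es)) : SubsetCoeff es := Prod.fst c

/-- The coefficients of the subsets with the first edge. -/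
def snd (c : SubsetCoeff (e :: es)) : SubsetCoeff es := Prod.snd c

/-- The coefficients of the subsets without and with an additional first edge. -/
def cons (a b : SubsetCoeff es) : SubsetCoeff (e :: es) := Prod.mk a b

/-- Negation of all coefficients. -/
def neg : (es : List (ℕ × ℕ)) → SubsetCoeff es → SubsetCoeff es
  | [], c => const (Int.neg c.value)
  | _ :: es, c => cons (neg es c.fst) (neg es c.snd)

/-- Coefficientwise subtraction. -/
def sub : (es : List (ℕ × ℕ)) → SubsetCoeff es → SubsetCoeff es → SubsetCoeff es
  | [], c, d => const (Int.sub c.value d.value)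
  | _ :: es, c, d => cons (sub es c.fst d.fst) (sub es c.snd d.snd)

/-- The polynomial with the given coefficients; the edge `(u, v)` stands for `q u * q v`. -/
def eval (q : ℕ → ℚ) : (es : List (ℕ × ℕ)) → SubsetCoeff es → ℚ
  | [], c => c.value
  | e :: es, c => eval q es c.fst + q e.1 * q e.2 * eval q es c.snd

theorem eval_cons (q : ℕ → ℚ) (a b : SubsetCoeff es) :
    eval q (e :: es) (cons a b) = eval q es a + q e.1 * q e.2 * eval q es b := rfl

theorem eval_neg (q : ℕ → ℚ) (es : List (ℕ × ℕ)) (c : SubsetCoeff es) :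
    eval q es (neg es c) = - eval q es c := by
  induction es with
  | nil => exact Int.cast_neg (R := ℚ) c.value
  | cons e es ih => rw [neg, eval_cons, ih, ih, eval]; ring

theorem eval_sub (q : ℕ → ℚ) (es : List (ℕ × ℕ)) (c d : SubsetCoeff es) :
    eval q es (sub es c d) = eval q es c - eval q es d := by
  induction es with
  | nil => exact Int.cast_sub (R := ℚ) c.value d.value
  | cons e es ih => rw [sub, eval_cons, ih, ih, eval, eval]; ring

end SubsetCoeff

/-- Merging the classes of `u` and `v` in a list of labels. -/
def mergeList (lab : List ℕ) (u v : ℕ) : List ℕ :=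
  lab.map fun x => bif Nat.beq x (lab.getD v 0) then lab.getD u 0 else x

theorem length_mergeList (lab : List ℕ) (u v : ℕ) : (mergeList lab u v).length = lab.length := by
  simp [mergeList]

theorem merge_getElem? {lab : List ℕ} {u v : ℕ} (hu : u < lab.length) (hv : v < lab.length) :
    merge (fun i => lab[i]?) u v = fun i => (mergeList lab u v)[i]? := by
  funext i
  simp only [merge, mergeList, List.getElem?_map, List.getElem?_eq_getElem hu,
    List.getElem?_eq_getElem hv, List.getD_eq_getElem _ _ hu, List.getD_eq_getElem _ _ hv]
  cases h : lab[i]? with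
  | none => simp
  | some a =>
    by_cases ha : a = lab[v]
    · simp [ha]
    · have hb : a.beq lab[v] = false :=
        (Bool.not_eq_true _).mp fun hb => ha (Nat.eq_of_beq_eq_true hb)
      simp [ha, hb]

theorem getElem?_eq_iff_beq {lab : List ℕ} {u v : ℕ} (hu : u < lab.length) (hv : v < lab.length) :
    lab[u]? = lab[v]? ↔ Nat.beq (lab.getD u 0) (lab.getD v 0) = true := by
  simp [hu, hv]

/-- The contribution of centered edges from the node `5`. -/
def centeredCoeff : List ℕ → List ℕ → ℤ
  | [], _ => 1
  | i :: F, lab => bif Nat.beq (lab.getD 5 0) (lab.getD i 0) then Int.neg (centeredCoeff F lab)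
      else Int.sub (centeredCoeff F (mergeList lab 5 i)) (centeredCoeff F lab)

/-- The coefficients of the expansion of the hub system. -/
def hubCoeff (F : List ℕ) : (es : List (ℕ × ℕ)) → List ℕ → SubsetCoeff es
  | [], lab => SubsetCoeff.const (centeredCoeff F lab)
  | e :: es, lab => SubsetCoeff.cons (hubCoeff F es lab)
      (bif Nat.beq (lab.getD e.1 0) (lab.getD e.2 0) then SubsetCoeff.neg es (hubCoeff F es lab)
      else SubsetCoeff.sub es (hubCoeff F es (mergeList lab e.1 e.2)) (hubCoeff F es lab))

/-- Both weights of each edge are ± q i, so the product of the q i factors out and an integer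
remains. -/
theorem evalLabels_centered (q : ℕ → ℚ) (F lab : List ℕ) (hlab : lab.length = 6)
    (hF : ∀ i ∈ F, i < 6) :
    evalLabels (F.map fun i => (5, i, -q i, q i)) (fun i => lab[i]?) =
      centeredCoeff F lab * (F.map q).prod := by
  induction F generalizing lab with
  | nil => simp [evalLabels, centeredCoeff]
  | cons i F ih =>
    have hi : i < lab.length := hlab ▸ hF i (by simp)
    have h5 : 5 < lab.length := by omega
    have hF' : ∀ i ∈ F, i < 6 := fun j hj => hF j (by simp [hj])
    rw [List.map_cons, evalLabels, ih lab hlab hF', List.map_cons, List.prod_cons, centeredCoeff,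
      merge_getElem? h5 hi, ih _ (by rw [length_mergeList, hlab]) hF']
    by_cases h : Nat.beq (lab.getD 5 0) (lab.getD i 0) = true
    · rw [if_pos ((getElem?_eq_iff_beq h5 hi).2 h), h, cond_true, show Int.neg _ = - _ from rfl]
      push_cast
      ring
    · rw [if_neg (fun h' => h ((getElem?_eq_iff_beq h5 hi).1 h')), (Bool.not_eq_true _).mp h,
        cond_false, show Int.sub _ _ = _ - _ from rfl]
      push_cast
      ring

/-- Writing the weight 1 - q_u q_v as two terms, the coefficient without the monomial of an edge is
that of deletion, and the coefficient with it is contraction minus deletion. -/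
theorem evalLabels_hub (q : ℕ → ℚ) (F : List ℕ) (es : List (ℕ × ℕ)) (lab : List ℕ)
    (hlab : lab.length = 6) (hF : ∀ i ∈ F, i < 6) (hes : ∀ e ∈ es, e.1 < 6 ∧ e.2 < 6) :
    evalLabels (es.map (fun e => (e.1, e.2, 1 - q e.1 * q e.2, q e.1 * q e.2)) ++
      F.map fun i => (5, i, -q i, q i)) (fun i => lab[i]?) =
      (hubCoeff F es lab).eval q es * (F.map q).prod := by
  induction es generalizing lab with
  | nil => exact evalLabels_centered q F lab hlab hF
  | cons e es ih =>
    obtain ⟨h1, h2⟩ := hes e (by simp)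
    rw [← hlab] at h1 h2
    have hes' : ∀ e ∈ es, e.1 < 6 ∧ e.2 < 6 := fun j hj => hes j (by simp [hj])
    rw [List.map_cons, List.cons_append, evalLabels, ih lab hlab hes', hubCoeff,
      SubsetCoeff.eval_cons, merge_getElem? h1 h2, ih _ (by rw [length_mergeList, hlab]) hes']
    by_cases h : Nat.beq (lab.getD e.1 0) (lab.getD e.2 0) = true
    · rw [if_pos ((getElem?_eq_iff_beq h1 h2).2 h), h, cond_true, SubsetCoeff.eval_neg]
      ring
    · rw [if_neg (fun h' => h ((getElem?_eq_iff_beq h1 h2).1 h')), (Bool.not_eq_true _).mp h,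
        cond_false, SubsetCoeff.eval_sub]
      ring

/-- Add a term to a polynomial, given as a list of exponents of moments and coefficients. -/
def addTerm (k : List ℕ) (c : ℤ) : List (List ℕ × ℤ) → List (List ℕ × ℤ)
  | [] => [(k, c)]
  | p :: l => if k = p.1 then (p.1, Int.add p.2 c) :: l else p :: addTerm k c l

/-- The value of a polynomial in the moments. -/
def momentEval (M : ℕ → ℚ) (P : List (List ℕ × ℤ)) : ℚ :=
  (P.map fun p => (p.2 : ℚ) * (p.1.map M).prod).sum

theorem momentEval_addTerm (M : ℕ → ℚ) (k : List ℕ) (c : ℤ) (P : List (List ℕ × ℤ)) :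
    momentEval M (addTerm k c P) = c * (k.map M).prod + momentEval M P := by
  induction P with
  | nil => simp [momentEval, addTerm]
  | cons p P ih =>
    rw [addTerm]
    split_ifs with h
    · subst h
      simp only [momentEval, List.map_cons, List.sum_cons, show Int.add p.2 c = p.2 + c from rfl]
      push_cast
      ring
    · simp only [momentEval, List.map_cons, List.sum_cons] at ih ⊢
      rw [ih]
      ring

/-- Increase an exponent. -/
def increment (d : List ℕ) (u : ℕ) : List ℕ := d.modify u (· + 1)

/-- Collect the coefficients according to the sorted list of exponents. Terms with an exponent one
are left out. -/
def collect : (es : List (ℕ × ℕ)) → SubsetCoeff es → List ℕ → List (List ℕ × ℤ) →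
    List (List ℕ × ℤ)
  | [], c, d, P => if c.value = 0 then P else
      if 1 ∈ d then P else addTerm (d.insertionSort (· ≤ ·)) c.value P
  | e :: es, c, d, P =>
      collect es c.snd (increment (increment d e.1) e.2) (collect es c.fst d P)

/-- The value at the moments `M` of the monomials of a polynomial, times those given by `d`. -/
def momentValue (M : ℕ → ℚ) : (es : List (ℕ × ℕ)) → SubsetCoeff es → List ℕ → ℚ
  | [], c, d => c.value * (d.map M).prod
  | e :: es, c, d => momentValue M es c.fst d +
      momentValue M es c.snd (increment (increment d e.1) e.2)

theorem momentEval_collect {M : ℕ → ℚ} (hM : M 1 = 0) (es : List (ℕ × ℕ)) (c : SubsetCoeff es)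
    (d : List ℕ) (P : List (List ℕ × ℤ)) :
    momentEval M (collect es c d P) = momentValue M es c d + momentEval M P := by
  induction es generalizing d P with
  | nil =>
    rw [collect, momentValue]
    split_ifs with h0 h1
    · rw [h0, Int.cast_zero]
      ring
    · rw [List.prod_eq_zero (List.mem_map.2 ⟨1, h1, hM⟩)]
      ring
    · rw [momentEval_addTerm, ((List.perm_insertionSort (· ≤ ·) d).map M).prod_eq]
  | cons e es ih =>
    rw [collect, momentValue, ih, ih]
    ring

/-- The weighted sum over all assignments of points to the five hubs. -/
def average (ω : Fin 6 → ℚ) (φ : (ℕ → ℚ) → ℚ) : ℚ :=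
  ∑ q : Fin 5 → Fin 6, (∏ i, ω (q i)) * φ fun i => if h : i < 5 then ((q ⟨i, h⟩ : ℕ) : ℚ) else 0

/-- The weights are a product over the hubs, so the average of a monomial factors into moments. -/
theorem average_monomial (ω : Fin 6 → ℚ) {d : List ℕ} (hd : d.length = 5) :
    average ω (fun q => ∏ i : Fin 5, q i ^ d.getD i 0) =
      (d.map fun t => ∑ a, ω a * ((a : ℕ) : ℚ) ^ t).prod := by
  have h1 : (d.map fun t => ∑ a, ω a * ((a : ℕ) : ℚ) ^ t).prod =
      ∏ i : Fin 5, ∑ a, ω a * ((a : ℕ) : ℚ) ^ d.getD i 0 := by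
    rw [← List.prod_ofFn]
    congr 1
    refine List.ext_getElem (by rw [List.length_map, List.length_ofFn, hd]) fun i hi _ => ?_
    rw [List.length_map] at hi
    rw [List.getElem_map, List.getElem_ofFn, List.getD_eq_getElem _ _ hi]
  rw [h1, Finset.prod_univ_sum, average, Fintype.piFinset_univ]
  refine Finset.sum_congr rfl fun q _ => ?_
  rw [← Finset.prod_mul_distrib]
  refine Finset.prod_congr rfl fun i _ => ?_
  simp

theorem prod_pow_increment (q : ℕ → ℚ) {d : List ℕ} (hd : d.length = 5) {u : ℕ} (hu : u < 5) :
    ∏ i : Fin 5, q i ^ (increment d u).getD (i : ℕ) 0 = q (u : ℕ) * ∏ i : Fin 5, q i ^ d.getD i 0 := by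
  rw [← Finset.mul_prod_erase _ _ (Finset.mem_univ (⟨u, hu⟩ : Fin 5)),
    ← Finset.mul_prod_erase _ (fun i : Fin 5 => q i ^ d.getD i 0)
      (Finset.mem_univ (⟨u, hu⟩ : Fin 5)), ← mul_assoc, ← pow_succ']
  congr 1
  · simp [increment, hd, hu]
  · refine Finset.prod_congr rfl fun i hi => ?_
    have : u ≠ (i : ℕ) := fun h => (Finset.mem_erase.1 hi).1 (Fin.ext h.symm)
    simp [increment, this]

theorem average_eval (ω : Fin 6 → ℚ) (es : List (ℕ × ℕ)) (hes : ∀ e ∈ es, e.1 < 5 ∧ e.2 < 5)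
    (c : SubsetCoeff es) {d : List ℕ} (hd : d.length = 5) :
    average ω (fun q => c.eval q es * ∏ i : Fin 5, q i ^ d.getD i 0) =
      momentValue (fun t => ∑ a, ω a * ((a : ℕ) : ℚ) ^ t) es c d := by
  induction es generalizing d with
  | nil =>
    rw [momentValue, ← average_monomial ω hd, average, average, Finset.mul_sum]
    refine Finset.sum_congr rfl fun q _ => ?_
    rw [SubsetCoeff.eval]
    ring
  | cons e es ih =>
    obtain ⟨h1, h2⟩ := hes e (by simp)
    have hes' : ∀ e ∈ es, e.1 < 5 ∧ e.2 < 5 := fun j hj => hes j (by simp [hj])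
    have hd1 : (increment d e.1).length = 5 := by rw [increment, List.length_modify, hd]
    have hd2 : (increment (increment d e.1) e.2).length = 5 := by
      rw [increment, List.length_modify, hd1]
    rw [momentValue, ← ih hes' c.fst hd, ← ih hes' c.snd hd2, average, average, average,
      ← Finset.sum_add_distrib]
    refine Finset.sum_congr rfl fun q _ => ?_
    set Q : ℕ → ℚ := fun i => if h : i < 5 then ((q ⟨i, h⟩ : ℕ) : ℚ) else 0
    rw [prod_pow_increment Q hd1 h2, prod_pow_increment Q hd h1, SubsetCoeff.eval]
    ring

end EdgeOp

/-! ### The quintic recursion for the moments -/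

namespace SierpinskiGasket

open EdgeOp Setoid

/-- The polynomial that gives the normalized moment `t` of the next stage. -/
def quintic : ℕ → List (List ℕ × ℤ)
  | 0 =>
      [([0, 0, 0, 0, 0], 1), ([0, 0, 2, 2, 2], -10), ([0, 2, 2, 2, 2], -15), ([0, 2, 2, 3, 3],
      60), ([0, 3, 3, 3, 3], -30), ([2, 2, 2, 3, 3], 140), ([2, 2, 2, 4, 4], -30), ([2, 2, 2,
      2, 4], 15), ([2, 2, 2, 2, 2], -12), ([2, 2, 3, 3, 4], -240), ([2, 3, 3, 3, 3], -180),
      ([2, 3, 3, 4, 4], 300), ([3, 3, 3, 3, 4], 210), ([3, 3, 4, 4, 4], -260), ([4, 4, 4, 4,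
      4], 51)]
  | 2 =>
      [([0, 0, 2, 2, 2], 3), ([2, 2, 2, 2, 4], -15), ([0, 2, 2, 2, 2], 6), ([2, 2, 2, 2, 2],
      5), ([2, 2, 2, 3, 3], -96), ([0, 2, 2, 3, 3], -42), ([2, 2, 3, 3, 4], 306), ([2, 3, 3,
      3, 3], 150), ([2, 2, 2, 4, 4], 39), ([2, 3, 3, 4, 4], -486), ([0, 3, 3, 3, 3], 18), ([3,
      3, 3, 3, 4], -240), ([3, 3, 4, 4, 4], 378), ([4, 4, 4, 4, 4], -51), ([0, 0, 0, 2, 2],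
      1), ([0, 2, 2, 2, 4], -6), ([2, 2, 2, 3, 5], 24), ([2, 3, 3, 3, 5], -108), ([0, 0, 2, 3,
      3], -6), ([0, 2, 3, 3, 4], 48), ([2, 2, 3, 4, 5], -108), ([3, 3, 3, 4, 5], 252), ([0, 2,
      2, 4, 4], 9), ([0, 3, 3, 4, 4], -30), ([2, 4, 4, 4, 4], 51), ([2, 2, 4, 4, 4], -42),
      ([2, 3, 4, 4, 5], 192), ([3, 4, 4, 4, 5], -252), ([2, 2, 2, 5, 5], -4), ([2, 3, 3, 5,
      5], 42), ([3, 3, 4, 5, 5], -114), ([4, 4, 4, 5, 5], 76)]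
  | 3 =>
      [([0, 2, 2, 2, 3], 14), ([2, 2, 2, 2, 3], 24), ([2, 2, 2, 3, 4], -102), ([2, 2, 3, 3,
      3], -150), ([2, 3, 3, 3, 4], 480), ([0, 2, 3, 3, 3], -36), ([2, 2, 3, 4, 4], 243), ([2,
      3, 4, 4, 4], -378), ([3, 3, 3, 3, 3], 64), ([3, 3, 3, 4, 4], -528), ([3, 4, 4, 4, 4],
      300), ([0, 0, 2, 2, 3], 3), ([2, 2, 2, 2, 5], -3), ([0, 2, 2, 3, 4], -24), ([2, 2, 3, 3,
      5], 81), ([2, 2, 2, 4, 5], 18), ([2, 3, 3, 4, 5], -378), ([0, 3, 3, 3, 4], 42), ([3, 3,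
      3, 3, 5], -90), ([3, 3, 4, 4, 5], 612), ([4, 4, 4, 4, 5], -177), ([0, 0, 3, 3, 3], -3),
      ([0, 2, 3, 4, 4], 30), ([2, 2, 3, 5, 5], -21), ([3, 3, 3, 5, 5], 72), ([0, 3, 4, 4, 4],
      -26), ([2, 4, 4, 4, 5], 126), ([2, 2, 4, 4, 5], -48), ([2, 3, 4, 5, 5], 114), ([3, 4, 4,
      5, 5], -306), ([3, 3, 5, 5, 5], -46), ([4, 4, 5, 5, 5], 93)]
  | 4 =>
      [([2, 2, 2, 2, 4], 13), ([2, 2, 2, 2, 2], -2), ([2, 2, 2, 3, 3], 68), ([2, 2, 3, 3, 4],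
      -324), ([2, 3, 3, 3, 3], -160), ([2, 3, 3, 4, 4], 756), ([2, 4, 4, 4, 4], -170), ([0, 2,
      2, 2, 4], 4), ([2, 2, 2, 3, 5], -24), ([2, 3, 3, 3, 5], 168), ([0, 2, 2, 2, 2], -1),
      ([0, 2, 2, 3, 3], 16), ([2, 2, 2, 4, 4], -28), ([0, 2, 3, 3, 4], -40), ([2, 2, 3, 4, 5],
      128), ([2, 2, 4, 4, 4], 68), ([2, 3, 4, 4, 5], -504), ([3, 3, 3, 3, 4], 352), ([3, 3, 3,
      4, 5], -544), ([3, 3, 4, 4, 4], -800), ([3, 4, 4, 4, 5], 944), ([0, 3, 3, 3, 3], -14),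
      ([0, 3, 3, 4, 4], 52), ([2, 3, 3, 5, 5], -76), ([3, 3, 4, 5, 5], 408), ([4, 4, 4, 4, 4],
      133), ([4, 4, 4, 5, 5], -424), ([0, 4, 4, 4, 4], -17), ([2, 4, 4, 5, 5], 152), ([3, 4,
      5, 5, 5], -248), ([4, 5, 5, 5, 5], 114)]
  | 5 =>
      [([2, 2, 2, 2, 5], 5), ([2, 2, 2, 2, 3], -15), ([2, 2, 2, 3, 4], 90), ([2, 2, 3, 3, 5],
      -105), ([2, 2, 3, 3, 3], 135), ([2, 2, 3, 4, 4], -240), ([2, 3, 3, 3, 4], -630), ([2, 3,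
      3, 4, 5], 570), ([2, 3, 4, 4, 4], 630), ([2, 4, 4, 4, 5], -380), ([3, 3, 3, 4, 4],
      1020), ([3, 3, 3, 5, 5], -230), ([3, 3, 3, 3, 5], 180), ([3, 3, 3, 3, 3], -90), ([3, 3,
      4, 4, 5], -1530), ([3, 4, 4, 4, 4], -885), ([3, 4, 4, 5, 5], 1395), ([4, 4, 4, 4, 5],
      795), ([4, 4, 5, 5, 5], -855), ([5, 5, 5, 5, 5], 140)]
  | _ => []

/-- The edges between the five hubs. -/
def hubPairs : List (ℕ × ℕ) :=
  [(0, 1), (0, 2), (0, 3), (0, 4), (1, 2), (1, 3), (1, 4), (2, 3), (2, 4), (3, 4)]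

/-- The expansion of the hub system into moments. -/
def expansion (t : ℕ) : List (List ℕ × ℤ) :=
  collect hubPairs (hubCoeff (List.range t) hubPairs [0, 1, 2, 3, 4, 5])
    ((List.range 5).map fun i => if i < t then 1 else 0) []

/-- A finite computation with the 2^10 subsets of the hub edges. The constant is the one in
`moment_eq`; it divides all coefficients, so the recursion for normalized moments is integral. -/
theorem expansion_eq {t : ℕ} (ht : t ∈ [0, 2, 3, 4, 5]) :
    expansion t = (quintic t).map fun p => (p.1, (-1) ^ t * (1 - (t : ℤ)) * p.2) := by
  have h : ∀ t ∈ [0, 2, 3, 4, 5],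
      expansion t = (quintic t).map fun p => (p.1, (-1) ^ t * (1 - (t : ℤ)) * p.2) := by
    decide +kernel
  exact h t ht

theorem momentEval_expansion {t : ℕ} (ht : t ∈ [0, 2, 3, 4, 5]) (M : ℕ → ℚ) :
    momentEval M (expansion t) = (-1) ^ t * (1 - t) * momentEval M (quintic t) := by
  rw [expansion_eq ht, momentEval, momentEval, List.map_map, ← List.sum_map_mul_left]
  congr 1
  refine List.map_congr_left fun p _ => ?_
  simp only [Function.comp_apply]
  push_cast
  ring

/-- The edges of the hub system as a list, with weights depending on the points `Q i`. -/
def hubList (t : ℕ) (Q : ℕ → ℚ) : List (ℕ × ℕ × ℚ × ℚ) :=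
  hubPairs.map (fun e => (e.1, e.2, 1 - Q e.1 * Q e.2, Q e.1 * Q e.2)) ++
    (List.range t).map fun i => (5, i, -Q i, Q i)

theorem map_val_hubEdges {t : ℕ} (ht : t ≤ 5) (Q : ℕ → ℚ) :
    (hubEdges t fun i => Q i).map (EdgeOp.map Fin.val) =
      (List.map (fun p => (⟨s(p.1, p.2.1), p.2.2.1, p.2.2.2⟩ : EdgeOp ℕ ℚ)) (hubList t Q) :
        Multiset _) := by
  rw [hubEdges, Finset.sum_filter, Fintype.sum_prod_type]
  simp only [Fin.sum_univ_five]
  interval_cases t <;> 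
    simp [hubList, hubPairs, EdgeOp.map, List.range_succ, ← Multiset.cons_coe,
      ← Multiset.singleton_add] <;> abel

theorem ev_hubEdges {t : ℕ} (ht : t ≤ 5) (Q : ℕ → ℚ) :
    ev (hubEdges t fun i => Q i) ⊥ =
      (hubCoeff (List.range t) hubPairs [0, 1, 2, 3, 4, 5]).eval Q hubPairs *
        ∏ i : Fin 5, Q i ^ ((List.range 5).map fun i => if i < t then 1 else 0).getD i 0 := by
  have h := ev_map (Fin.val : Fin 6 → ℕ) (hubEdges t fun i => Q i)
    (ker fun i => ([0, 1, 2, 3, 4, 5] : List ℕ)[i]?)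
  have hbot : (ker fun i => ([0, 1, 2, 3, 4, 5] : List ℕ)[i]?).comap (Fin.val : Fin 6 → ℕ) = ⊥ := by
    ext i j
    rw [comap_rel, ker_def]
    show _ ↔ i = j
    revert i j
    decide
  rw [hbot, map_val_hubEdges ht, ev_ker, hubList, evalLabels_hub _ _ _ _ rfl
    (fun i hi => (List.mem_range.1 hi).trans_le (by omega)) (by decide)] at h
  rw [← h]
  congr 1
  rw [Fin.prod_univ_five]
  interval_cases t <;> simp [List.range_succ, mul_assoc]

theorem moment_succ_eq_expansion {ω : Fin 6 → ℚ} {n : ℕ} (hω : Represents ω n)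
    (h1 : ∑ a, ω a * ((a : ℕ) : ℚ) ^ 1 = 0) {t : ℕ} (ht : t ≤ 5) :
    moment (n + 1) t = momentEval (fun t => ∑ a, ω a * ((a : ℕ) : ℚ) ^ t) (expansion t) := by
  rw [expansion, momentEval_collect h1, ← average_eval ω _ (by decide) _ (by simp),
    moment_succ_eq hω, average, momentEval]
  rw [List.map_nil, List.sum_nil, add_zero]
  refine Finset.sum_congr rfl fun q _ => ?_
  rw [← ev_hubEdges ht]
  congr 3
  simp

/-- The moments of the weights that represent a stage. -/
noncomputable def normalizedMoment (n t : ℕ) : ℚ := moment n t / ((-1) ^ t * (1 - t))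

theorem sum_mul_pow_eq_normalizedMoment {ω : Fin 6 → ℚ} {n : ℕ} (hω : Represents ω n)
    (h1 : ∑ a, ω a * ((a : ℕ) : ℚ) ^ 1 = 0) {t : ℕ} (ht : t ≤ 5) :
    ∑ a, ω a * ((a : ℕ) : ℚ) ^ t = normalizedMoment n t := by
  by_cases ht1 : t = 1
  · subst ht1
    rw [h1, normalizedMoment]
    simp
  · have : (1 - t : ℚ) ≠ 0 := sub_ne_zero.2 (by exact_mod_cast Ne.symm ht1)
    rw [normalizedMoment, moment_eq hω ht]
    field_simp

/-- The block conditions fix the moments 0, 2, 3, 4, 5 and leave the first one free. Six distinct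
points carry weights with any prescribed moments 0 to 5, by the Vandermonde determinant. -/
theorem exists_represents (n : ℕ) : ∃ ω : Fin 6 → ℚ, Represents ω n ∧
    ∑ a, ω a * ((a : ℕ) : ℚ) ^ 1 = 0 := by
  set z := blockCount n
  -- The solution of the triangular system of `blockCount_eq`, with first moment 0.
  set m : Fin 6 → ℚ := ![z 1, 0, z 1 - z 2, (z 3 - 3 * z 2 + 2 * z 1) / 2,
    -(z 4 - 4 * z 3 + 6 * z 2 - 3 * z 1) / 3,
    (z 5 - 5 * z 4 + 10 * z 3 - 10 * z 2 + 4 * z 1) / 4] with hm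
  have hdet : IsUnit (Matrix.vandermonde fun a : Fin 6 => ((a : ℕ) : ℚ)).det :=
    isUnit_iff_ne_zero.2 (Matrix.det_vandermonde_ne_zero_iff.2
      fun a b h => Fin.ext (by exact_mod_cast h))
  set ω := Matrix.vecMul m (Matrix.vandermonde fun a : Fin 6 => ((a : ℕ) : ℚ))⁻¹ with hω
  have key : Matrix.vecMul ω (Matrix.vandermonde fun a : Fin 6 => ((a : ℕ) : ℚ)) = m := by
    rw [hω, Matrix.vecMul_vecMul, Matrix.nonsing_inv_mul _ hdet, Matrix.vecMul_one]
  have hsum : ∀ t : Fin 6, ∑ a, ω a * ((a : ℕ) : ℚ) ^ (t : ℕ) = m t := fun t => by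
    rw [← key]
    rfl
  refine ⟨ω, fun k hk => ?_, by simpa [hm] using hsum 1⟩
  have h0 := hsum 0
  have h1 := hsum 1
  have h2 := hsum 2
  have h3 := hsum 3
  have h4 := hsum 4
  have h5 := hsum 5
  generalize ω = w at *
  simp [hm, Fin.sum_univ_six] at h0 h1 h2 h3 h4 h5
  simp only [Fin.sum_univ_six]
  interval_cases k <;> norm_num <;> linarith

theorem normalizedMoment_succ (n : ℕ) {t : ℕ} (ht : t ∈ [0, 2, 3, 4, 5]) :
    normalizedMoment (n + 1) t = momentEval (normalizedMoment n) (quintic t) := by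
  obtain ⟨ω, hω, h1⟩ := exists_represents n
  have ht5 : t ≤ 5 := by revert t; decide
  have hc : ((-1) ^ t * (1 - t) : ℚ) ≠ 0 := by
    fin_cases ht <;> norm_num
  rw [normalizedMoment, moment_succ_eq_expansion hω h1 ht5, momentEval_expansion ht,
    mul_div_cancel_left₀ _ hc, momentEval, momentEval]
  congr 1
  refine List.map_congr_left fun p hp => ?_
  congr 2
  refine List.map_congr_left fun j hj => sum_mul_pow_eq_normalizedMoment hω h1 ?_
  have : ∀ t ∈ [0, 2, 3, 4, 5], ∀ p ∈ quintic t, ∀ j ∈ p.1, j ≤ 5 := by decide +kernel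
  exact this t ht p hp j hj

theorem blockCount_eq (n : ℕ) {k : ℕ} (hk : k < 5) : blockCount n (k + 1) =
    ![normalizedMoment n 0, normalizedMoment n 0 - normalizedMoment n 2,
      normalizedMoment n 0 - 3 * normalizedMoment n 2 + 2 * normalizedMoment n 3,
      normalizedMoment n 0 - 6 * normalizedMoment n 2 + 8 * normalizedMoment n 3 -
        3 * normalizedMoment n 4,
      normalizedMoment n 0 - 10 * normalizedMoment n 2 + 20 * normalizedMoment n 3 -
        15 * normalizedMoment n 4 + 4 * normalizedMoment n 5] ⟨k, hk⟩ := by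
  obtain ⟨ω, hω, h1⟩ := exists_represents n
  have h := fun t ht => sum_mul_pow_eq_normalizedMoment hω h1 (t := t) ht
  rw [← h 0 (by norm_num), ← h 2 (by norm_num), ← h 3 (by norm_num), ← h 4 (by norm_num),
    ← h 5 le_rfl, ← hω k hk]
  simp only [Fin.sum_univ_six] at h1 ⊢
  interval_cases k <;> norm_num <;> ring

end SierpinskiGasket

/-! ### Evaluation of the first stages -/

namespace SierpinskiGasket

open EdgeOp Setoid

/-- The edges at stage `0`. -/
def simplexPairs : List (Fin 5 × Fin 5) :=
  [(0, 1), (0, 2), (0, 3), (0, 4), (1, 2), (1, 3), (1, 4), (2, 3), (2, 4), (3, 4)]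

theorem blockCount_zero (k : ℕ) : blockCount 0 k =
    evalLabels (simplexPairs.map fun e => ((e.1, e.2, 1, 1) : Fin 5 × Fin 5 × ℚ × ℚ))
      fun i : Fin 5 => if (i : ℕ) < k then 0 else (i : ℕ) := by
  have h : (Finset.univ.filter fun e : Sym2 (Fin 5) => ¬ e.IsDiag).val =
      (simplexPairs.map fun e => s(e.1, e.2) : List (Sym2 (Fin 5))) := by
    decide
  rw [blockCount, boundary, edges, count_map, ev_map, comap_extend (corner_injective 0), block,
    ← ev_ker, h]
  rfl

theorem normalizedMoment_zero {t : ℕ} (ht : t < 6) :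
    normalizedMoment 0 t = ([291, 0, 198, 163, 134, 110] : List ℤ).getD t 0 := by
  have e1 := blockCount_eq 0 (k := 0) (by norm_num)
  have e2 := blockCount_eq 0 (k := 1) (by norm_num)
  have e3 := blockCount_eq 0 (k := 2) (by norm_num)
  have e4 := blockCount_eq 0 (k := 3) (by norm_num)
  have e5 := blockCount_eq 0 (k := 4) (by norm_num)
  rw [blockCount_zero] at e1 e2 e3 e4 e5
  have h1 : normalizedMoment 0 1 = 0 := by simp [normalizedMoment]
  -- Forests of the complete graph on five vertices that stay forests when the first k+1 vertices
  -- are identified; the moments follow by inverting `blockCount_eq`.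
  have f : ∀ k : Fin 5, evalLabels
      (simplexPairs.map fun e => ((e.1, e.2, 1, 1) : Fin 5 × Fin 5 × ℚ × ℚ))
      (fun i : Fin 5 => if (i : ℕ) < k + 1 then 0 else (i : ℕ)) = ![291, 93, 23, 5, 1] k := by
    decide +kernel
  have f0 := f 0
  have f1 := f 1
  have f2 := f 2
  have f3 := f 3
  have f4 := f 4
  simp at e1 e2 e3 e4 e5 f0 f1 f2 f3 f4
  interval_cases t <;> simp <;> linarith

/-- Continue with an evaluated natural number. -/
def forceNat {α : Type} : ℕ → (ℕ → α) → α
  | 0, k => k 0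
  | n + 1, k => k (n + 1)

theorem forceNat_eq {α : Type} (n : ℕ) (k : ℕ → α) : forceNat n k = k n := by
  cases n <;> rfl

/-- Continue with an evaluated integer. -/
def forceInt {α : Type} : ℤ → (ℤ → α) → α
  | .ofNat n, k => forceNat n fun n => k (.ofNat n)
  | .negSucc n, k => forceNat n fun n => k (.negSucc n)

theorem forceInt_eq {α : Type} (x : ℤ) (k : ℤ → α) : forceInt x k = k x := by
  cases x <;> simp [forceInt, forceNat_eq]

/-- Continue with an evaluated list of integers. -/
def forceList {α : Type} : List ℤ → (List ℤ → α) → α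
  | [], k => k []
  | x :: l, k => forceInt x fun y => forceList l fun l => k (y :: l)

theorem forceList_eq {α : Type} (l : List ℤ) (k : List ℤ → α) : forceList l k = k l := by
  induction l generalizing k with
  | nil => rfl
  | cons x l ih => simp only [forceList, forceInt_eq, ih]

/-- The value of a polynomial at integral moments. -/
def momentEvalInt (m : List ℤ) (P : List (List ℕ × ℤ)) : ℤ :=
  P.foldr (fun p s => Int.add (Int.mul p.2 (p.1.foldr (fun j r => Int.mul (m.getD j 0) r) 1)) s) 0

/-- The moments of the next stage. -/
def nextMoments (m : List ℤ) : List ℤ :=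
  [0, 1, 2, 3, 4, 5].map fun t => momentEvalInt m (quintic t)

/-- Test the moments after some more stages. -/
def testMoments : ℕ → List ℤ → (List ℤ → Bool) → Bool
  | 0, m, test => test m
  | n + 1, m, test => forceList (nextMoments m) fun m => testMoments n m test

/-- The moments of a stage, computed by the recursion. -/
def momentList : ℕ → List ℤ
  | 0 => [291, 0, 198, 163, 134, 110]
  | n + 1 => nextMoments (momentList n)

theorem testMoments_eq (n k : ℕ) (test : List ℤ → Bool) :
    testMoments n (momentList k) test = test (momentList (k + n)) := by
  induction n generalizing k with
  | zero => rfl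
  | succ n ih =>
    rw [testMoments, forceList_eq, ← momentList, ih, Nat.succ_add_eq_add_succ]

theorem momentEvalInt_cast {m : List ℤ} {M : ℕ → ℚ} {P : List (List ℕ × ℤ)}
    (h : ∀ p ∈ P, ∀ j ∈ p.1, M j = m.getD j 0) : (momentEvalInt m P : ℚ) = momentEval M P := by
  have hprod : ∀ l : List ℕ, (∀ j ∈ l, M j = m.getD j 0) →
      ((l.foldr (fun j r => Int.mul (m.getD j 0) r) 1 : ℤ) : ℚ) = (l.map M).prod := by
    intro l hl
    induction l with
    | nil => simp
    | cons j l ih =>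
      rw [List.foldr_cons, List.map_cons, List.prod_cons, hl j (by simp),
        ← ih fun i hi => hl i (by simp [hi])]
      exact Int.cast_mul _ _
  induction P with
  | nil => simp [momentEvalInt, momentEval]
  | cons p P ih =>
    have := ih fun i hi => h i (by simp [hi])
    rw [momentEval] at this ⊢
    rw [List.map_cons, List.sum_cons, ← this, ← hprod p.1 (h p (by simp))]
    exact (Int.cast_add _ _).trans (congrArg (· + _) (Int.cast_mul _ _))

theorem normalizedMoment_eq (n : ℕ) {t : ℕ} (ht : t < 6) :
    normalizedMoment n t = (momentList n).getD t 0 := by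
  induction n generalizing t with
  | zero => exact normalizedMoment_zero ht
  | succ n ih =>
    have hget : (momentList (n + 1)).getD t 0 = momentEvalInt (momentList n) (quintic t) := by
      interval_cases t <;> rfl
    rw [hget]
    by_cases ht1 : t = 1
    · subst ht1
      simp [normalizedMoment, quintic, momentEvalInt]
    · have ht' : t ∈ [0, 2, 3, 4, 5] := by
        interval_cases t <;> simp at ht1 ⊢
      rw [normalizedMoment_succ n ht']
      refine (momentEvalInt_cast fun p hp j hj => ih ?_).symm
      have : ∀ t ∈ [0, 2, 3, 4, 5], ∀ p ∈ quintic t, ∀ j ∈ p.1, j < 6 := by decide +kernel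
      exact this t ht' p hp j hj

/-- The first bound is for F_6; the combination in the second is B_7, read off from `blockCount_eq`
with k = 4. Mantissas of 28 bits are precise enough for the logarithms. -/
theorem momentList_six_seven :
    (momentList 6).getD 0 0 ≤ ((227634533 * 2 ^ 111613 : ℕ) : ℤ) ∧
    ((235429599 * 2 ^ 558176 : ℕ) : ℤ) ≤ (momentList 7).getD 0 0 - 10 * (momentList 7).getD 2 0 +
      20 * (momentList 7).getD 3 0 - 15 * (momentList 7).getD 4 0 +
        4 * (momentList 7).getD 5 0 := by
  -- The test at stage 7 is nested in the one at stage 6, so one run of the recursion serves both.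
  have h : testMoments 6 (momentList 0) (fun m =>
      decide (m.getD 0 0 ≤ ((227634533 * 2 ^ 111613 : ℕ) : ℤ)) && testMoments 1 m fun m =>
        decide (((235429599 * 2 ^ 558176 : ℕ) : ℤ) ≤ m.getD 0 0 - 10 * m.getD 2 0 + 20 * m.getD 3 0 -
          15 * m.getD 4 0 + 4 * m.getD 5 0)) = true := by
    decide +kernel
  rw [testMoments_eq, Nat.zero_add, testMoments_eq, Bool.and_eq_true, decide_eq_true_iff,
    decide_eq_true_iff] at h
  exact h

end SierpinskiGasket

/-! ### Growth of the number of forests -/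

namespace SierpinskiGasket

open EdgeOp Setoid Filter Topology

/-- The number of spanning forests at stage `n`. -/
noncomputable def forestCount (n : ℕ) : ℚ := ev (count ℚ (edges 4 n)) ⊥

theorem ev_copy_le (n : ℕ) (i : Fin 5) (r : Setoid (Fin 5 → ℕ)) :
    ev (count ℚ ((edges 4 n).map (Sym2.map (shift n i)))) r ≤ forestCount n := by
  rw [count_map, ev_map]
  exact ev_count_anti _ bot_le

/-- Identifications caused by the other copies can only lower the number of choices in a copy. -/
theorem forestCount_succ_le (n : ℕ) : forestCount (n + 1) ≤ forestCount n ^ 5 := by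
  have h : ∀ s : Finset (Fin 5), ∀ r,
      ev (count ℚ (∑ i ∈ s, (edges 4 n).map (Sym2.map (shift n i)))) r ≤ forestCount n ^ s.card := by
    intro s
    induction s using Finset.induction_on with
    | empty => simp
    | insert i s hi ih =>
      intro r
      rw [Finset.sum_insert hi, add_comm (Multiset.map _ _), Finset.card_insert_of_notMem hi, pow_succ]
      refine (ev_count_add_le _ _ _ (ev_copy_le n i) r).trans ?_
      exact mul_le_mul_of_nonneg_right (ih r) (zero_le_one.trans (one_le_ev_count _ _))
  exact h Finset.univ ⊥

theorem block_five : block 5 = ⊤ := by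
  ext i j
  rw [block, Setoid.ker_def, if_pos i.isLt, if_pos j.isLt]
  exact ⟨fun _ => trivial, fun _ => rfl⟩

/-- When only corners are identified, identifying all of them is the most restrictive case. -/
theorem blockCount_five_le_ev_copy {n : ℕ} {i : Fin 5} {r : Setoid (Fin 5 → ℕ)}
    (hr : ∀ x ∈ sierpinskiVertices 4 n, (∀ b, corner n b ≠ x) → r.Isolated (shift n i x)) :
    blockCount n 5 ≤ ev (count ℚ ((edges 4 n).map (Sym2.map (shift n i)))) r := by
  rw [count_map, ev_map_eq_boundary (corner_injective n) (S := {x | x ∈ sierpinskiVertices 4 n})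
    (fun o ho x hx => mem_vertices_of_mem_edges (mem_count ho) hx) (shift n i) r
    fun x hx hb y hy => shift_injective n i (hr x hx hb _ hy), blockCount, block_five, boundary,
    boundary]
  refine ev_count_anti _ fun x y hxy => ?_
  by_cases hx : ∃ b, corner n b = x
  · by_cases hy : ∃ b, corner n b = y
    · obtain ⟨b, rfl⟩ := hx
      obtain ⟨c, rfl⟩ := hy
      exact (extend_rel (corner_injective n) _).2 trivial
    · rw [← (extend_isolated _ (not_exists.1 hy)) _ (symm' _ hxy)]
  · rw [(extend_isolated _ (not_exists.1 hx)) _ hxy]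

theorem blockCount_five_pow_le (n : ℕ) : blockCount n 5 ^ 5 ≤ blockCount (n + 1) 5 := by
  have h0 : 0 ≤ blockCount n 5 := zero_le_one.trans (one_le_ev_count _ _)
  have h : ∀ s : Finset (Fin 5), ∀ r : Setoid (Fin 5 → ℕ),
      (∀ i ∈ s, ∀ x ∈ sierpinskiVertices 4 n, (∀ b, corner n b ≠ x) → r.Isolated (shift n i x)) →
      blockCount n 5 ^ s.card ≤
        ev (count ℚ (∑ i ∈ s, (edges 4 n).map (Sym2.map (shift n i)))) r := by
    intro s
    induction s using Finset.induction_on with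
    | empty => simp
    | insert i s hi ih =>
      intro r hr
      rw [Finset.sum_insert hi, add_comm (Multiset.map _ _), Finset.card_insert_of_notMem hi, pow_succ]
      refine (mul_le_mul_of_nonneg_right
        (ih r fun j hj => hr j (Finset.mem_insert_of_mem hj)) h0).trans
        (le_ev_count_add _ _ _ (fun r => ∀ x ∈ sierpinskiVertices 4 n, (∀ b, corner n b ≠ x) →
          r.Isolated (shift n i x)) (fun r hr => blockCount_five_le_ev_copy hr) ?_ r
          (hr i (Finset.mem_insert_self _ _)))
      intro e he r hr x hx hb
      refine (hr x hx hb).glue fun hxe => ?_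
      obtain ⟨j, hj, he⟩ := Multiset.mem_sum.1 he
      obtain ⟨f, -, rfl⟩ := Multiset.mem_map.1 he
      obtain ⟨y, -, hy⟩ := Sym2.mem_map.1 hxe
      have hij : i ≠ j := fun h => hi (h ▸ hj)
      exact hb j (eq_corner_of_shift_eq hij hx hy.symm).symm
  -- The identification of the outmost vertices of stage n+1 leaves the interior vertices of every
  -- copy isolated.
  refine h Finset.univ _ fun i _ x hx hb => extend_isolated _ fun b h => ?_
  have := shift_ne_shift_corner (i := i) (j := b) (b := b) hx hb
  rw [shift_corner_self] at this
  exact this h.symm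

theorem blockCount_five_le (n : ℕ) : blockCount n 5 ≤ forestCount n :=
  ev_count_anti _ bot_le

theorem one_le_blockCount_five (n : ℕ) : 1 ≤ blockCount n 5 := one_le_ev_count _ _

theorem normalizedMoment_zero_right (n : ℕ) : normalizedMoment n 0 = forestCount n := by
  rw [normalizedMoment, moment_zero, forestCount]
  simp

/-- The exponent is a variable here, so that moving the casts never expands the power. -/
theorem cast_le_mul_two_pow {a : ℤ} {b k : ℕ} (h : a ≤ (b * 2 ^ k : ℕ)) : (a : ℚ) ≤ b * 2 ^ k := by
  exact_mod_cast h

theorem mul_two_pow_le_cast {v w x y z : ℤ} {b k : ℕ}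
    (h : (b * 2 ^ k : ℕ) ≤ v - 10 * w + 20 * x - 15 * y + 4 * z) :
    (b * 2 ^ k : ℚ) ≤ v - 10 * w + 20 * x - 15 * y + 4 * z := by
  exact_mod_cast h

theorem forestCount_six_le : forestCount 6 ≤ ((227634533 : ℕ) : ℚ) * 2 ^ 111613 := by
  rw [← normalizedMoment_zero_right, normalizedMoment_eq 6 (by norm_num)]
  exact cast_le_mul_two_pow momentList_six_seven.1

theorem blockCount_five_eq (n : ℕ) : blockCount n 5 =
    (momentList n).getD 0 0 - 10 * (momentList n).getD 2 0 + 20 * (momentList n).getD 3 0 -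
      15 * (momentList n).getD 4 0 + 4 * (momentList n).getD 5 0 := by
  have h0 := blockCount_eq n (k := 4) (by norm_num)
  have h : blockCount n 5 = normalizedMoment n 0 - 10 * normalizedMoment n 2 +
      20 * normalizedMoment n 3 - 15 * normalizedMoment n 4 + 4 * normalizedMoment n 5 :=
    h0
  rw [h, normalizedMoment_eq n (by norm_num), normalizedMoment_eq n (by norm_num),
    normalizedMoment_eq n (by norm_num), normalizedMoment_eq n (by norm_num),
    normalizedMoment_eq n (by norm_num)]

theorem le_blockCount_seven : ((235429599 : ℕ) : ℚ) * 2 ^ 558176 ≤ blockCount 7 5 :=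
  blockCount_five_eq 7 ▸ mul_two_pow_le_cast momentList_six_seven.2

end SierpinskiGasket

/-! ### Logarithms -/

theorem Real.abs_log_one_sub_add_sum_le {x : ℝ} (h0 : 0 < x) (h1 : x ≤ 1 / 2) (n : ℕ) :
    |∑ i ∈ Finset.range n, x ^ (i + 1) / (i + 1) + Real.log (1 - x)| ≤ 2 * x ^ (n + 1) := by
  refine (Real.abs_log_sub_add_sum_range_le (by rw [abs_of_pos h0]; linarith) n).trans ?_
  rw [abs_of_pos h0, div_le_iff₀ (by linarith)]
  have := pow_pos h0 (n + 1)
  nlinarith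

theorem abs_log_two_sub_le : |Real.log 2 - 0.693147180559945| ≤ 1 / 10 ^ 14 := by
  -- With 48 terms the error is at most 2 · 2^(-49), below 10^(-14).
  have h := Real.abs_log_one_sub_add_sum_le (x := 1 / 2) (by norm_num) le_rfl 48
  have e : (1 : ℝ) - 1 / 2 = 2⁻¹ := by norm_num
  rw [e, Real.log_inv, abs_le] at h
  norm_num [Finset.sum_range_succ] at h
  rw [abs_le]
  constructor <;> norm_num <;> linarith

theorem log_upper_mantissa_le : Real.log 227634533 ≤ 28 * Real.log 2 - 0.16486908 := by
  -- Dividing by 2^28 brings the mantissa to 1 - x with x near 0.152, so 12 terms leave an error of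
  -- at most 2 x^13, less than 10^(-10).
  have h := Real.abs_log_one_sub_add_sum_le (x := 1 - 227634533 / 2 ^ 28) (by norm_num)
    (by norm_num) 12
  rw [sub_sub_cancel, Real.log_div (by norm_num) (by norm_num), Real.log_pow, abs_le] at h
  norm_num [Finset.sum_range_succ] at h
  linarith [h.1, h.2]

theorem le_log_lower_mantissa : 28 * Real.log 2 - 0.131198572 ≤ Real.log 235429599 := by
  have h := Real.abs_log_one_sub_add_sum_le (x := 1 - 235429599 / 2 ^ 28) (by norm_num)
    (by norm_num) 12
  rw [sub_sub_cancel, Real.log_div (by norm_num) (by norm_num), Real.log_pow, abs_le] at h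
  norm_num [Finset.sum_range_succ] at h
  linarith [h.1, h.2]

/-! ### Squeezing the growth constant -/

namespace SierpinskiGasket

open Filter Topology

/-- The logarithm of the number of spanning forests at stage `n`, over the number of copies of
stage `0`. -/
noncomputable def logRatio (n : ℕ) : ℝ := Real.log (forestCount n) / 5 ^ n

/-- The analogue of `logRatio` with all outmost vertices identified. -/
noncomputable def blockLogRatio (n : ℕ) : ℝ := Real.log (blockCount n 5) / 5 ^ n

theorem blockCount_five_pos (n : ℕ) : (0 : ℝ) < blockCount n 5 := by
  exact_mod_cast zero_lt_one.trans_le (one_le_blockCount_five n)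

theorem forestCount_pos (n : ℕ) : (0 : ℝ) < forestCount n := by
  exact_mod_cast zero_lt_one.trans_le ((one_le_blockCount_five n).trans (blockCount_five_le n))

theorem antitone_logRatio : Antitone logRatio := by
  refine antitone_nat_of_succ_le fun n => ?_
  have h : (forestCount (n + 1) : ℝ) ≤ forestCount n ^ 5 := by
    exact_mod_cast forestCount_succ_le n
  have h' := Real.log_le_log (forestCount_pos _) h
  rw [Real.log_pow] at h'
  rw [logRatio, logRatio, div_le_div_iff₀ (by positivity) (by positivity), pow_succ]
  calc _ ≤ ((5 : ℕ) * Real.log (forestCount n)) * 5 ^ n :=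
        mul_le_mul_of_nonneg_right h' (by positivity)
    _ = _ := by push_cast; ring

theorem monotone_blockLogRatio : Monotone blockLogRatio := by
  refine monotone_nat_of_le_succ fun n => ?_
  have h : (blockCount n 5 : ℝ) ^ 5 ≤ blockCount (n + 1) 5 := by
    exact_mod_cast blockCount_five_pow_le n
  have h' := Real.log_le_log (pow_pos (blockCount_five_pos _) 5) h
  rw [Real.log_pow] at h'
  rw [blockLogRatio, blockLogRatio, div_le_div_iff₀ (by positivity) (by positivity), pow_succ]
  calc _ = ((5 : ℕ) * Real.log (blockCount n 5)) * 5 ^ n := by push_cast; ring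
    _ ≤ _ := mul_le_mul_of_nonneg_right h' (by positivity)

theorem blockLogRatio_le_logRatio (m n : ℕ) : blockLogRatio m ≤ logRatio n := by
  refine (monotone_blockLogRatio (le_max_left m n)).trans
    (le_trans ?_ (antitone_logRatio (le_max_right m n)))
  have h : (blockCount (max m n) 5 : ℝ) ≤ forestCount (max m n) := by
    exact_mod_cast blockCount_five_le _
  exact div_le_div_of_nonneg_right (Real.log_le_log (blockCount_five_pos _) h) (by positivity)

theorem log_nat_mul_two_pow {b : ℕ} (hb : b ≠ 0) (k : ℕ) :
    Real.log (((b * 2 ^ k : ℚ)) : ℝ) = Real.log b + k * Real.log 2 := by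
  push_cast
  rw [Real.log_mul (by exact_mod_cast hb) (by positivity), Real.log_pow]

theorem logRatio_six_lt : logRatio 6 < 5 / 2 * 1.98101707561 := by
  have h1 := Real.log_le_log (forestCount_pos 6) (Rat.cast_le.2 forestCount_six_le)
  rw [log_nat_mul_two_pow (by norm_num)] at h1
  have h2 := log_upper_mantissa_le
  have h3 := (abs_le.1 abs_log_two_sub_le).2
  rw [logRatio, div_lt_iff₀ (by positivity)]
  refine h1.trans_lt ?_
  push_cast
  norm_num at h3 ⊢
  linarith

theorem le_blockLogRatio_seven : 5 / 2 * 1.98101707560 ≤ blockLogRatio 7 := by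
  have h0 : (0 : ℝ) < (((235429599 : ℕ) : ℚ) * 2 ^ 558176 : ℚ) :=
    Rat.cast_pos.2 (mul_pos (by norm_num) (pow_pos (by norm_num) _))
  have h1 := Real.log_le_log h0 (Rat.cast_le.2 le_blockCount_seven)
  rw [log_nat_mul_two_pow (by norm_num)] at h1
  have h2 := le_log_lower_mantissa
  have h3 := (abs_le.1 abs_log_two_sub_le).1
  rw [blockLogRatio, le_div_iff₀ (by positivity)]
  refine le_trans ?_ h1
  push_cast
  norm_num at h3 ⊢
  linarith

/-- There are 5/2 · (5^n + 1) vertices; the last factor corrects 5^n + 1 to 5^n and tends to 1. -/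
theorem log_numSpanningForests_div_card (n : ℕ) :
    Real.log (numSpanningForests (sierpinskiGasket 4 n) : ℝ) /
      (Fintype.card (sierpinskiVertices 4 n) : ℝ) =
      2 / 5 * logRatio n * (1 - 1 / (5 ^ n + 1)) := by
  have h1 : ((numSpanningForests (sierpinskiGasket 4 n) : ℕ) : ℝ) = forestCount n := by
    rw [forestCount, ← numSpanningForests_eq_ev, Rat.cast_natCast]
  have h2 : (Fintype.card (sierpinskiVertices 4 n) : ℝ) = 5 / 2 * (5 ^ n + 1) := by
    rw [Fintype.card_coe]
    have : (2 : ℝ) * (sierpinskiVertices 4 n).card = 5 * (5 ^ n + 1) := by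
      exact_mod_cast two_mul_card_vertices n
    linarith
  have h3 : (5 : ℝ) ^ n + 1 ≠ 0 := by positivity
  rw [h1, h2, logRatio]
  field_simp
  ring

theorem exists_growth_constant :
    ∃ z : ℝ,
      Filter.Tendsto
        (fun n : ℕ => Real.log (numSpanningForests (sierpinskiGasket 4 n) : ℝ) /
          (Fintype.card (sierpinskiVertices 4 n) : ℝ))
        Filter.atTop (nhds z) ∧
      (1.98101707560 : ℝ) ≤ z ∧ z < (1.98101707561 : ℝ) := by
  have hbdd : BddBelow (Set.range logRatio) :=
    ⟨blockLogRatio 7, by rintro _ ⟨n, rfl⟩; exact blockLogRatio_le_logRatio 7 n⟩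
  have hL := tendsto_atTop_ciInf antitone_logRatio hbdd
  set L := ⨅ n, logRatio n
  have hL1 : blockLogRatio 7 ≤ L := le_ciInf (blockLogRatio_le_logRatio 7)
  have hL2 : L ≤ logRatio 6 := ciInf_le hbdd 6
  refine ⟨2 / 5 * L, ?_, ?_, ?_⟩
  · simp only [log_numSpanningForests_div_card]
    have h5 : Tendsto (fun n : ℕ => (5 : ℝ) ^ n + 1) atTop atTop :=
      tendsto_atTop_add_const_right _ _ (tendsto_pow_atTop_atTop_of_one_lt (by norm_num))
    have h := (hL.const_mul (2 / 5)).mul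
      (tendsto_const_nhds (x := (1 : ℝ)).sub (tendsto_const_nhds (x := (1 : ℝ)).div_atTop h5))
    simpa using h
  · linarith [le_blockLogRatio_seven]
  · linarith [logRatio_six_lt]

end SierpinskiGasket

theorem proposition5 :
    ∃ z : ℝ,
      Filter.Tendsto
        (fun n : ℕ => Real.log (numSpanningForests (sierpinskiGasket 4 n) : ℝ) /
          (Fintype.card (sierpinskiVertices 4 n) : ℝ))
        Filter.atTop (nhds z) ∧
      (1.98101707560 : ℝ) ≤ z ∧ z < (1.98101707561 : ℝ) := by
  exact SierpinskiGasket.exists_growth_constant
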